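/- Let $\mathbb D$ be the open unit disk of $\mathbb C$ with the normalized area measure $d\mathscr A=\frac{dx\,dy}{\pi}$, and let $\phi\colon\mathbb D\to\mathbb D$ be analytic. An Orlicz function is a non-decreasing, strictly convex function $\Psi\colon[0,\infty)\to[0,\infty)$, continuous at $0$, with $\Psi(0)=0$ and $\Psi(x)/x\to\infty$ as $x\to\infty$; it is a bijection of $[0,\infty)$, with inverse $\Psi^{-1}$. We write $\Psi\in\Delta^2$ if there is $\alpha>1$ such that $\Psi(x)^2\le\Psi(\alpha x)$ for all large enough $x$. The Bergman–Orlicz space $\mathscr B^\Psi$ is the space of analytic functions $f\colon\mathbb D\to\mathbb C$ such that $\int_{\mathbb D}\Psi(|f|/C)\,d\mathscr A<\infty$ for some $C>0$, with the Luxemburg norm $\|f\|_\Psi=\inf\{C>0 : \int_{\mathbb D}\Psi(|f|/C)\,d\mathscr A\le1\}$, and $C_\phi f=f\circ\phi$. 1. For every Orlicz function $\Psi$: if $C_\phi\colon\mathscr B^\Psi\to\mathscr B^\Psi$ is compact, then $$\frac{\Psi^{-1}\big(1/(1-|\phi(a)|)^2\big)}{\Psi^{-1}\big(1/(1-|a|)^2\big)}\longrightarrow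 0\qquad\text{as } |a|\to1,\ |a|<1.\tag{$*$}$$ 2. If $\Psi\in\Delta^2$ and $(*)$ holds, then $C_\phi\colon\mathscr B^\Psi\to\mathscr B^\Psi$ is (bounded and) compact. 3. For $\Psi=\Psi_2$, $\Psi_2(x)=e^{x^2}-1$, condition $(*)$ holds if and only if for every $\varepsilon>0$ there is $c_\varepsilon>0$ such that $$1-|\phi(z)|\ge c_\varepsilon(1-|z|)^\varepsilon\qquad\text{for all } z\in\mathbb D,$$ and this is in turn equivalent to the compactness of $C_\phi\colon\mathscr B^{\Psi_2}\to\mathscr B^{\Psi_2}$. -/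

import Mathlib

open MeasureTheory Set Filter Topology

noncomputable section

/-- Orlicz functions. Strict convexity forces finiteness on `[0, ∞)`, so an Orlicz function is given
by its restriction to `[0, ∞)`; the values of `toFun` at negative reals play no role. -/
structure OrliczFunction where
  toFun : ℝ → ℝ
  map_zero' : toFun 0 = 0
  monotoneOn' : MonotoneOn toFun (Ici 0)
  strictConvexOn' : StrictConvexOn ℝ (Ici 0) toFun
  continuousWithinAt_zero' : ContinuousWithinAt toFun (Ici 0) 0
  tendsto_div' : Tendsto (fun x => toFun x / x) atTop atTop

namespace OrliczFunction

instance : CoeFun OrliczFunction (fun _ => ℝ → ℝ) := ⟨toFun⟩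

/-- The inverse `Ψ⁻¹ : [0, ∞) → [0, ∞)` of the bijection `Ψ : [0, ∞) → [0, ∞)`. -/
def inv (Ψ : OrliczFunction) : ℝ → ℝ := Function.invFunOn Ψ (Ici 0)

/-- The fast growth condition `Δ²`. -/
def DeltaSq (Ψ : OrliczFunction) : Prop :=
  ∃ α : ℝ, 1 < α ∧ ∀ᶠ x in atTop, Ψ x ^ 2 ≤ Ψ (α * x)

lemma nonneg (Ψ : OrliczFunction) {x : ℝ} (hx : 0 ≤ x) : 0 ≤ Ψ x :=
  Ψ.map_zero' ▸ Ψ.monotoneOn' self_mem_Ici hx hx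

lemma pos (Ψ : OrliczFunction) {x : ℝ} (hx : 0 < x) : 0 < Ψ x := by
  have h := Ψ.strictConvexOn'.2 (self_mem_Ici (a := (0 : ℝ))) (mem_Ici.2 hx.le) hx.ne
    (show (0 : ℝ) < 1 / 2 by norm_num) (show (0 : ℝ) < 1 / 2 by norm_num) (by norm_num)
  have h2 := Ψ.nonneg (x := (1 / 2 : ℝ) • (0 : ℝ) + (1 / 2 : ℝ) • x)
    (by simp only [smul_eq_mul]; linarith)
  rw [Ψ.map_zero'] at h
  simp only [smul_eq_mul] at h h2
  linarith

lemma le_mul (Ψ : OrliczFunction) {x t : ℝ} (hx : 0 ≤ x) (ht : 0 ≤ t) (ht1 : t ≤ 1) :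
    Ψ (t * x) ≤ t * Ψ x := by
  have h := Ψ.strictConvexOn'.convexOn.2 (self_mem_Ici (a := (0 : ℝ))) (mem_Ici.2 hx)
    (show 0 ≤ 1 - t by linarith) ht (by ring)
  simpa [Ψ.map_zero'] using h

lemma measurable_comp (Ψ : OrliczFunction) {α : Type*} [MeasurableSpace α] {g : α → ℝ}
    (hg : Measurable g) (h0 : ∀ a, 0 ≤ g a) : Measurable (fun a => Ψ (g a)) := by
  have hm : Monotone (fun x : ℝ => Ψ (max x 0)) := fun x y h =>
    Ψ.monotoneOn' (mem_Ici.2 (le_max_right _ _)) (mem_Ici.2 (le_max_right _ _)) (max_le_max_right _ h)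
  have h := hm.measurable.comp hg
  have he : (fun a => Ψ (g a)) = (fun x : ℝ => Ψ (max x 0)) ∘ g := by
    funext a
    simp [h0 a]
  rwa [he]

lemma bijOn (Ψ : OrliczFunction) : BijOn Ψ (Ici 0) (Ici 0) := by
  refine ⟨fun x hx => Ψ.nonneg hx, StrictMonoOn.injOn (fun x hx y hy hxy => ?_), fun y hy => ?_⟩
  · have hx0 : (0 : ℝ) ≤ x := hx
    have hy0 : 0 < y := hx0.trans_lt hxy
    have h := Ψ.le_mul hy0.le (div_nonneg hx0 hy0.le) ((div_le_one hy0).2 hxy.le)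
    rw [div_mul_cancel₀ _ hy0.ne'] at h
    have := mul_lt_mul_of_pos_right ((div_lt_one hy0).2 hxy) (Ψ.pos hy0)
    linarith
  · have hcont : ContinuousOn Ψ (Ici 0) := by
      intro x hx
      rcases eq_or_lt_of_le (mem_Ici.1 hx) with rfl | hx'
      · exact Ψ.continuousWithinAt_zero'
      · have := Ψ.strictConvexOn'.convexOn.continuousOn_interior
        rw [interior_Ici] at this
        exact (this.continuousAt (Ioi_mem_nhds hx')).continuousWithinAt
    obtain ⟨x, hx1, hx⟩ := ((eventually_ge_atTop (max 1 y)).and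
      (Ψ.tendsto_div'.eventually_ge_atTop 1)).exists
    have hx0 : 0 < x := one_pos.trans_le ((le_max_left _ _).trans hx1)
    rw [le_div_iff₀ hx0, one_mul] at hx
    obtain ⟨z, hz, hzy⟩ := intermediate_value_Icc hx0.le (hcont.mono Icc_subset_Ici_self)
      ⟨Ψ.map_zero'.trans_le hy, ((le_max_right _ _).trans hx1).trans hx⟩
    exact ⟨z, hz.1, hzy⟩

/-- The Orlicz function `Ψ₂(x) = exp(x²) - 1`. -/
def expSq : OrliczFunction where
  toFun x := Real.exp (x ^ 2) - 1
  map_zero' := by simp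
  monotoneOn' := by
    intro x hx y _ hxy
    have h : x ^ 2 ≤ y ^ 2 := pow_le_pow_left₀ hx hxy 2
    simpa using h
  strictConvexOn' := by
    have h : StrictConvexOn ℝ (Ici 0) (Real.exp ∘ fun x : ℝ => x ^ 2) := by
      refine ⟨convex_Ici 0, ?_⟩
      intro x hx y hy hxy a b ha hb hab
      have h1 := (strictConvexOn_pow (n := 2) le_rfl).2 hx hy hxy ha hb hab
      have h2 := convexOn_exp.2 (mem_univ (x ^ 2)) (mem_univ (y ^ 2)) ha.le hb.le hab
      exact (Real.exp_lt_exp.2 h1).trans_le h2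
    have h' := h.add_const (-1)
    simp only [sub_eq_add_neg]
    exact h'
  continuousWithinAt_zero' := by
    apply Continuous.continuousWithinAt
    fun_prop
  tendsto_div' := by
    refine tendsto_atTop_mono' _ ?_ tendsto_id
    filter_upwards [eventually_gt_atTop 0] with x hx
    have := Real.add_one_le_exp (x ^ 2)
    rw [le_div_iff₀ hx]
    simp only [id]
    nlinarith

end OrliczFunction

/-- The open unit disk of the complex plane. -/
abbrev Disk : Type := ↥(Metric.ball (0 : ℂ) 1)

namespace Disk

/-- Analytic functions on the open unit disk. -/
def Analytic (f : Disk → ℂ) : Prop :=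
  ∃ F : ℂ → ℂ, DifferentiableOn ℂ F (Metric.ball 0 1) ∧ ∀ z : Disk, f z = F z

lemma Analytic.continuous {f : Disk → ℂ} (hf : Analytic f) : Continuous f := by
  obtain ⟨F, hF, h⟩ := hf
  have : f = (Metric.ball (0 : ℂ) 1).domRestrict F := funext h
  rw [this]
  exact hF.continuousOn.domRestrict

/-- The normalized area measure `dx dy / π` on the unit disk. -/
def area : Measure Disk :=
  (ENNReal.ofReal Real.pi)⁻¹ • Measure.comap (Subtype.val : Disk → ℂ) volume

lemma area_open_pos {U : Set Disk} (hU : IsOpen U) (h : area U = 0) : U = ∅ := by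
  have hm : MeasurableEmbedding (Subtype.val : Disk → ℂ) :=
    MeasurableEmbedding.subtype_coe measurableSet_ball
  rw [area, Measure.smul_apply, hm.comap_apply, smul_eq_mul, mul_eq_zero] at h
  have h' := h.resolve_left (by simp)
  have ho : IsOpen ((Subtype.val : Disk → ℂ) '' U) :=
    Metric.isOpen_ball.isOpenMap_subtype_val U hU
  exact image_eq_empty.1 ((ho.measure_eq_zero_iff volume).1 h')

end Disk

/-- The modular `∫ Ψ(|f| / C) d𝒜`. -/
def orliczModular (Ψ : OrliczFunction) (f : Disk → ℂ) (C : ℝ) : ENNReal :=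
  ∫⁻ z, ENNReal.ofReal (Ψ (‖f z‖ / C)) ∂Disk.area

/-- The Luxemburg norm. -/
def luxemburgNorm (Ψ : OrliczFunction) (f : Disk → ℂ) : ℝ :=
  sInf {C : ℝ | 0 < C ∧ orliczModular Ψ f C ≤ 1}

lemma orliczModular_add_le (Ψ : OrliczFunction) {f g : Disk → ℂ} (hf : Continuous f)
    {C D : ℝ} (hC : 0 < C) (hD : 0 < D) :
    orliczModular Ψ (f + g) (C + D) ≤
      ENNReal.ofReal (C / (C + D)) * orliczModular Ψ f C
        + ENNReal.ofReal (D / (C + D)) * orliczModular Ψ g D := by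
  have hCD : 0 < C + D := add_pos hC hD
  have hmf : Measurable fun z => ENNReal.ofReal (Ψ (‖f z‖ / C)) :=
    (Ψ.measurable_comp (hf.norm.measurable.div_const C) fun z => by positivity).ennreal_ofReal
  unfold orliczModular
  rw [← lintegral_const_mul _ hmf, ← lintegral_const_mul' _ _ ENNReal.ofReal_ne_top,
    ← lintegral_add_left (hmf.const_mul _)]
  refine lintegral_mono fun z => ?_
  have hf0 : 0 ≤ ‖f z‖ / C := by positivity
  have hg0 : 0 ≤ ‖g z‖ / D := by positivity
  rw [← ENNReal.ofReal_mul (by positivity), ← ENNReal.ofReal_mul (by positivity),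
    ← ENNReal.ofReal_add (mul_nonneg (by positivity) (Ψ.nonneg hf0))
      (mul_nonneg (by positivity) (Ψ.nonneg hg0))]
  refine ENNReal.ofReal_le_ofReal ?_
  have hc := Ψ.strictConvexOn'.convexOn.2 (mem_Ici.2 hf0) (mem_Ici.2 hg0)
    (show 0 ≤ C / (C + D) by positivity) (show 0 ≤ D / (C + D) by positivity) (by field_simp)
  simp only [smul_eq_mul] at hc
  refine le_trans (Ψ.monotoneOn' (mem_Ici.2 (by positivity)) (mem_Ici.2 (by positivity)) ?_) hc
  have : C / (C + D) * (‖f z‖ / C) + D / (C + D) * (‖g z‖ / D) = (‖f z‖ + ‖g z‖) / (C + D) := by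
    field_simp
  rw [this]
  gcongr
  exact norm_add_le _ _

lemma orliczModular_mul_le (Ψ : OrliczFunction) (f : Disk → ℂ) {C N : ℝ} (hC : 0 < C)
    (hN : 1 ≤ N) :
    orliczModular Ψ f (C * N) ≤ ENNReal.ofReal N⁻¹ * orliczModular Ψ f C := by
  have hN0 : 0 < N := by linarith
  unfold orliczModular
  rw [← lintegral_const_mul' _ _ ENNReal.ofReal_ne_top]
  refine lintegral_mono fun z => ?_
  rw [← ENNReal.ofReal_mul (by positivity)]
  refine ENNReal.ofReal_le_ofReal ?_
  have : ‖f z‖ / (C * N) = N⁻¹ * (‖f z‖ / C) := by field_simp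
  rw [this]
  exact Ψ.le_mul (by positivity) (by positivity) (inv_le_one_of_one_le₀ hN)

lemma orliczModular_smul (Ψ : OrliczFunction) (f : Disk → ℂ) {c : ℂ} (hc : c ≠ 0) (C : ℝ) :
    orliczModular Ψ (c • f) (‖c‖ * C) = orliczModular Ψ f C := by
  unfold orliczModular
  refine lintegral_congr fun z => ?_
  have : ‖c‖ ≠ 0 := norm_ne_zero_iff.2 hc
  simp only [Pi.smul_apply, smul_eq_mul, norm_mul]
  rw [mul_div_mul_left _ _ this]

lemma orliczModular_zero (Ψ : OrliczFunction) (C : ℝ) : orliczModular Ψ 0 C = 0 := by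
  simp [orliczModular, Ψ.map_zero']

lemma exists_orliczModular_le_one (Ψ : OrliczFunction) {f : Disk → ℂ} {C : ℝ} (hC : 0 < C)
    (h : orliczModular Ψ f C < ⊤) :
    {C : ℝ | 0 < C ∧ orliczModular Ψ f C ≤ 1}.Nonempty := by
  set M := (orliczModular Ψ f C).toReal with hM
  have hM0 : 0 ≤ M := ENNReal.toReal_nonneg
  refine ⟨C * (M + 1), by positivity,
    (orliczModular_mul_le Ψ f hC (by linarith)).trans ?_⟩
  rw [← ENNReal.ofReal_toReal h.ne, ← hM, ← ENNReal.ofReal_mul (by positivity),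
    ENNReal.ofReal_le_one, inv_mul_le_iff₀ (by positivity)]
  linarith

lemma luxemburgNorm_bddBelow (Ψ : OrliczFunction) (f : Disk → ℂ) :
    BddBelow {C : ℝ | 0 < C ∧ orliczModular Ψ f C ≤ 1} := ⟨0, fun _ h => h.1.le⟩

/-- The analytic functions on the disk that belong to the Orlicz space `L^Ψ(𝔻, 𝒜)`, as a linear
subspace of the space of all functions on the disk. -/
def bergmanOrliczSubmodule (Ψ : OrliczFunction) : Submodule ℂ (Disk → ℂ) where
  carrier := {f | Disk.Analytic f ∧ ∃ C : ℝ, 0 < C ∧ orliczModular Ψ f C < ⊤}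
  zero_mem' := ⟨⟨0, differentiableOn_const 0, fun _ => rfl⟩, 1, one_pos, by
    simp [orliczModular_zero]⟩
  add_mem' := by
    rintro f g ⟨hf, C, hC, hfC⟩ ⟨hg, D, hD, hgD⟩
    refine ⟨?_, C + D, add_pos hC hD, (orliczModular_add_le Ψ hf.continuous hC hD).trans_lt ?_⟩
    · obtain ⟨F, hF, hfF⟩ := hf
      obtain ⟨G, hG, hgG⟩ := hg
      exact ⟨F + G, hF.add hG, fun z => by simp [hfF, hgG]⟩
    · exact ENNReal.add_lt_top.2 ⟨ENNReal.mul_lt_top ENNReal.ofReal_lt_top hfC,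
        ENNReal.mul_lt_top ENNReal.ofReal_lt_top hgD⟩
  smul_mem' := by
    rintro c f ⟨⟨F, hF, hfF⟩, C, hC, hfC⟩
    refine ⟨⟨c • F, hF.const_smul c, fun z => by simp [hfF]⟩, ?_⟩
    rcases eq_or_ne c 0 with rfl | hc
    · exact ⟨1, one_pos, by simp [orliczModular_zero]⟩
    · exact ⟨‖c‖ * C, mul_pos (norm_pos_iff.2 hc) hC, by rwa [orliczModular_smul Ψ f hc]⟩

/-- The Bergman–Orlicz space `𝓑^Ψ`. It is a type of its own, so that its topology is the one of the
Luxemburg norm below and not that of pointwise convergence. -/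
def BergmanOrlicz (Ψ : OrliczFunction) : Type := ↥(bergmanOrliczSubmodule Ψ)

namespace BergmanOrlicz

variable {Ψ : OrliczFunction}

instance : AddCommGroup (BergmanOrlicz Ψ) :=
  inferInstanceAs (AddCommGroup ↥(bergmanOrliczSubmodule Ψ))

instance : Module ℂ (BergmanOrlicz Ψ) :=
  inferInstanceAs (Module ℂ ↥(bergmanOrliczSubmodule Ψ))

instance : CoeFun (BergmanOrlicz Ψ) (fun _ => Disk → ℂ) := ⟨fun f => f.1⟩

instance : Norm (BergmanOrlicz Ψ) := ⟨fun f => luxemburgNorm Ψ f⟩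

lemma norm_def (f : BergmanOrlicz Ψ) : ‖f‖ = luxemburgNorm Ψ f := rfl

lemma nonempty_set (f : BergmanOrlicz Ψ) :
    {C : ℝ | 0 < C ∧ orliczModular Ψ f C ≤ 1}.Nonempty := by
  obtain ⟨-, C, hC, h⟩ := f.2
  exact exists_orliczModular_le_one Ψ hC h

lemma norm_nonneg' (f : BergmanOrlicz Ψ) : 0 ≤ ‖f‖ :=
  Real.sInf_nonneg fun _ h => h.1.le

lemma norm_add_le' (f g : BergmanOrlicz Ψ) : ‖f + g‖ ≤ ‖f‖ + ‖g‖ := by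
  refine le_of_forall_pos_le_add fun ε hε => ?_
  obtain ⟨C, ⟨hC, hfC⟩, hCε⟩ := exists_lt_of_csInf_lt f.nonempty_set
    (show luxemburgNorm Ψ f < luxemburgNorm Ψ f + ε / 2 by linarith)
  obtain ⟨D, ⟨hD, hgD⟩, hDε⟩ := exists_lt_of_csInf_lt g.nonempty_set
    (show luxemburgNorm Ψ g < luxemburgNorm Ψ g + ε / 2 by linarith)
  have hCD : 0 < C + D := add_pos hC hD
  have h : orliczModular Ψ ((f : Disk → ℂ) + g) (C + D) ≤ 1 := by
    refine (orliczModular_add_le Ψ f.2.1.continuous hC hD).trans ?_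
    calc _ ≤ ENNReal.ofReal (C / (C + D)) * 1 + ENNReal.ofReal (D / (C + D)) * 1 := by gcongr
      _ = 1 := by
        rw [mul_one, mul_one, ← ENNReal.ofReal_add (by positivity) (by positivity), ← add_div,
          div_self hCD.ne', ENNReal.ofReal_one]
  have h2 : ‖f + g‖ ≤ C + D := csInf_le (luxemburgNorm_bddBelow Ψ _) ⟨hCD, h⟩
  rw [norm_def f, norm_def g]
  linarith

lemma norm_zero' : ‖(0 : BergmanOrlicz Ψ)‖ = 0 := by
  refine le_antisymm (le_of_forall_pos_le_add fun ε hε => ?_) (norm_nonneg' _)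
  rw [zero_add]
  exact csInf_le (luxemburgNorm_bddBelow Ψ _) ⟨hε, (orliczModular_zero Ψ ε).trans_le zero_le_one⟩

lemma norm_smul_le' (c : ℂ) (f : BergmanOrlicz Ψ) : ‖c • f‖ ≤ ‖c‖ * ‖f‖ := by
  rcases eq_or_ne c 0 with rfl | hc
  · rw [zero_smul, norm_zero', norm_zero, zero_mul]
  · have hc' : 0 < ‖c‖ := norm_pos_iff.2 hc
    rw [← div_le_iff₀' hc']
    refine le_csInf f.nonempty_set fun C hC => ?_
    rw [div_le_iff₀' hc']
    exact csInf_le (luxemburgNorm_bddBelow Ψ _)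
      ⟨mul_pos hc' hC.1, (orliczModular_smul Ψ f hc C).trans_le hC.2⟩

lemma norm_smul' (c : ℂ) (f : BergmanOrlicz Ψ) : ‖c • f‖ = ‖c‖ * ‖f‖ := by
  refine le_antisymm (norm_smul_le' c f) ?_
  rcases eq_or_ne c 0 with rfl | hc
  · rw [norm_zero, zero_mul]; exact norm_nonneg' _
  · have hc' : 0 < ‖c‖ := norm_pos_iff.2 hc
    have h := norm_smul_le' c⁻¹ (c • f)
    rw [inv_smul_smul₀ hc, norm_inv] at h
    rwa [le_inv_mul_iff₀ hc'] at h

lemma eq_zero_of_norm_eq_zero {f : BergmanOrlicz Ψ} (h : ‖f‖ = 0) : f = 0 := by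
  have key : ∀ ε : ℝ, 0 < ε → ε ≤ 1 → orliczModular Ψ f 1 ≤ ENNReal.ofReal ε := by
    intro ε hε hε1
    obtain ⟨C, ⟨hC, hfC⟩, hCε⟩ := exists_lt_of_csInf_lt f.nonempty_set
      (show luxemburgNorm Ψ f < ε by rw [← norm_def, h]; exact hε)
    have h1 : 1 ≤ C⁻¹ := (one_le_inv₀ hC).2 (hCε.le.trans hε1)
    have h2 := orliczModular_mul_le Ψ f hC h1
    rw [mul_inv_cancel₀ hC.ne', inv_inv] at h2
    calc _ ≤ _ := h2
      _ ≤ ENNReal.ofReal C * 1 := by gcongr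
      _ ≤ _ := by rw [mul_one]; exact ENNReal.ofReal_le_ofReal hCε.le
  have hz : orliczModular Ψ f 1 = 0 := by
    refine le_antisymm (ENNReal.le_of_forall_pos_le_add fun ε hε _ => ?_) zero_le
    have := key (min ε 1) (lt_min (by exact_mod_cast hε) one_pos) (min_le_right _ _)
    rw [zero_add]
    exact this.trans (by
      rw [← ENNReal.ofReal_coe_nnreal]; exact ENNReal.ofReal_le_ofReal (min_le_left _ _))
  have hcont : Continuous (f : Disk → ℂ) := f.2.1.continuous
  have hm : Measurable fun z => ENNReal.ofReal (Ψ (‖f z‖ / 1)) :=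
    (Ψ.measurable_comp (hcont.norm.measurable.div_const 1) fun z => by positivity).ennreal_ofReal
  have hae := (lintegral_eq_zero_iff hm).1 hz
  have hU : Disk.area {z | f z ≠ 0} = 0 := by
    refine measure_mono_null (fun z hz' => ?_) (ae_iff.1 hae)
    have : 0 < Ψ (‖f z‖ / 1) := Ψ.pos (by rw [div_one]; exact norm_pos_iff.2 hz')
    simpa using this
  have hemp := Disk.area_open_pos (isOpen_ne_fun hcont continuous_const) hU
  apply Subtype.ext
  funext z
  by_contra hne
  exact (hemp ▸ (show z ∈ {z | f z ≠ 0} from hne) : z ∈ (∅ : Set Disk))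

lemma core : NormedSpace.Core ℂ (BergmanOrlicz Ψ) where
  norm_nonneg := norm_nonneg'
  norm_smul := norm_smul'
  norm_triangle := norm_add_le'
  norm_eq_zero_iff _ := ⟨eq_zero_of_norm_eq_zero, fun h => h ▸ norm_zero'⟩

instance : NormedAddCommGroup (BergmanOrlicz Ψ) := NormedAddCommGroup.ofCore core

instance : NormedSpace ℂ (BergmanOrlicz Ψ) := NormedSpace.ofCore core

end BergmanOrlicz

/-- `C_φ : f ↦ f ∘ φ` maps `𝓑^Ψ` into itself, boundedly, and is a compact operator there. The
continuous linear map `T` is determined by `φ`. -/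
def IsCompactCompositionOperator (Ψ : OrliczFunction) (φ : Disk → Disk) : Prop :=
  ∃ T : BergmanOrlicz Ψ →L[ℂ] BergmanOrlicz Ψ,
    (∀ (f : BergmanOrlicz Ψ) (z : Disk), T f z = f (φ z)) ∧ IsCompactOperator T

/-- `Ψ⁻¹(1 / (1 - |φ(a)|)²) / Ψ⁻¹(1 / (1 - |a|)²) → 0` as `|a| → 1`, `|a| < 1`. -/
def BergmanCompactCondition (Ψ : OrliczFunction) (φ : Disk → Disk) : Prop :=
  Tendsto (fun a : Disk => Ψ.inv (1 / (1 - ‖(φ a : ℂ)‖) ^ 2) / Ψ.inv (1 / (1 - ‖(a : ℂ)‖) ^ 2))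
    (comap (fun a : Disk => ‖(a : ℂ)‖) (𝓝[<] 1)) (𝓝 0)

/-- For every `ε > 0` there is `c > 0` with `1 - |φ(z)| ≥ c (1 - |z|)^ε` for all `z` in the disk. -/
def PowerCondition (φ : Disk → Disk) : Prop :=
  ∀ ε : ℝ, 0 < ε → ∃ c : ℝ, 0 < c ∧ ∀ z : Disk, c * (1 - ‖(z : ℂ)‖) ^ ε ≤ 1 - ‖(φ z : ℂ)‖

end

/-! Write `s(z) = Ψ⁻¹(1 / (1 - |z|)²)`. Since `Ψ(|f|)` is subharmonic, averaging over the disk of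
radius `1 - |z|` about `z` gives `|f(z)| ≤ ‖f‖ s(z)`. Condition `(*)` says that `s(φ(a)) / s(a) →
0`.

Necessity: the functions `s(b) ((1 - |b|) / (1 - b̄z))⁴` have norm at most `1`, because the peak is
bounded by `1`, has `L¹`-norm at most `(1 - |b|)²`, and `Ψ(tx) ≤ tΨ(x)` for `t ≤ 1`. They tend to
`0` pointwise as `|b| → 1`, so a compact `C_φ` sends them to `0` in norm (`tendsto_norm_map_test`).
Evaluating the image at `a` with `b = φ(a)` bounds `s(φ(a)) / s(a)` by `16` times a norm that tends
to `0` when `|φ(a)| → 1`.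

Sufficiency: two uses of `Δ²` make `Ψ(β s(z))` at most `(1 - |z|)^(-1/2)` near the circle, for some
`β > 0`, and this is integrable. Under `(*)`, a function with growth `2s` that is small on a fixed
compact disk therefore has a composition with `φ` of small norm
(`exists_orliczModular_comp_le_one`). Hence `f ↦ f ∘ φ` is continuous from the analytic functions
with `|f| ≤ s`, under pointwise convergence, into `𝓑^Ψ`. That class is compact (Montel) and contains
the unit ball, so `C_φ` is compact.

For `Ψ₂`, `s(z)² = log(1 + (1 - |z|)⁻²)`, so `(*)` compares `log(1 - |φ(z)|)` with `log(1 - |z|)`,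
which is the power condition. -/

open scoped ComplexConjugate

/-! ### The inverse of an Orlicz function -/

namespace OrliczFunction

variable (Ψ : OrliczFunction)

lemma strictMonoOn : StrictMonoOn Ψ (Ici 0) := fun _ hx _ hy hxy =>
  (Ψ.monotoneOn' hx hy hxy.le).lt_of_ne fun h => hxy.ne (Ψ.bijOn.injOn hx hy h)

lemma continuousOn : ContinuousOn Ψ (Ici 0) := by
  intro x hx
  rcases eq_or_lt_of_le (mem_Ici.1 hx) with rfl | hx'
  · exact Ψ.continuousWithinAt_zero'
  · have := Ψ.strictConvexOn'.convexOn.continuousOn_interior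
    rw [interior_Ici] at this
    exact (this.continuousAt (Ioi_mem_nhds hx')).continuousWithinAt

variable {Ψ}

lemma inv_nonneg {y : ℝ} (hy : 0 ≤ y) : 0 ≤ Ψ.inv y :=
  Function.invFunOn_mem (Ψ.bijOn.surjOn hy)

lemma apply_inv {y : ℝ} (hy : 0 ≤ y) : Ψ (Ψ.inv y) = y :=
  Function.invFunOn_eq (Ψ.bijOn.surjOn hy)

lemma le_inv_iff {x y : ℝ} (hx : 0 ≤ x) (hy : 0 ≤ y) : x ≤ Ψ.inv y ↔ Ψ x ≤ y := by
  rw [← Ψ.strictMonoOn.le_iff_le hx (inv_nonneg hy), apply_inv hy]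

lemma inv_le_iff {x y : ℝ} (hx : 0 ≤ x) (hy : 0 ≤ y) : Ψ.inv y ≤ x ↔ y ≤ Ψ x := by
  rw [← Ψ.strictMonoOn.le_iff_le (inv_nonneg hy) hx, apply_inv hy]

lemma inv_le_inv {x y : ℝ} (hx : 0 ≤ x) (hxy : x ≤ y) : Ψ.inv x ≤ Ψ.inv y := by
  rwa [le_inv_iff (inv_nonneg hx) (hx.trans hxy), apply_inv hx]

lemma inv_pos {y : ℝ} (hy : 0 < y) : 0 < Ψ.inv y := by
  refine (inv_nonneg hy.le).lt_of_ne fun h => hy.ne ?_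
  rw [← apply_inv (Ψ := Ψ) hy.le, ← h, Ψ.map_zero']

lemma tendsto_inv_atTop : Tendsto Ψ.inv atTop atTop := by
  refine tendsto_atTop.2 fun b => ?_
  filter_upwards [eventually_ge_atTop (Ψ (max b 0))] with y hy
  have h0 : 0 ≤ max b 0 := le_max_right _ _
  exact (le_max_left b 0).trans ((le_inv_iff h0 ((Ψ.nonneg h0).trans hy)).2 hy)

/-- Convexity and `Ψ(0) = 0` make `Ψ` grow at least linearly. This caps the height of the test
functions. -/
lemma inv_le_mul {t : ℝ} (ht : 1 ≤ t) : Ψ.inv t ≤ Ψ.inv 1 * t := by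
  have h1 : 0 ≤ Ψ.inv 1 := inv_nonneg zero_le_one
  have ht0 : 0 < t := one_pos.trans_le ht
  rw [inv_le_iff (by positivity) ht0.le]
  have h := Ψ.le_mul (x := Ψ.inv 1 * t) (t := t⁻¹) (by positivity) (by positivity)
    (inv_le_one_of_one_le₀ ht)
  rw [show t⁻¹ * (Ψ.inv 1 * t) = Ψ.inv 1 by field_simp, apply_inv zero_le_one,
    le_inv_mul_iff₀ ht0] at h
  simpa using h

end OrliczFunction

/-! ### Normalized area, mean value inequalities and point evaluations -/

lemma Disk.norm_lt_one (z : Disk) : ‖(z : ℂ)‖ < 1 := mem_ball_zero_iff.1 z.2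

lemma Disk.lintegral_area (G : ℂ → ENNReal) :
    ∫⁻ z : Disk, G z ∂Disk.area
      = (ENNReal.ofReal Real.pi)⁻¹ * ∫⁻ z in Metric.ball (0 : ℂ) 1, G z := by
  rw [Disk.area, lintegral_smul_measure, smul_eq_mul,
    lintegral_subtype_comap measurableSet_ball]

lemma Disk.area_univ : Disk.area univ = 1 := by
  have h := Disk.lintegral_area 1
  simp only [Pi.one_apply, lintegral_one, Measure.restrict_apply_univ, Complex.volume_ball] at h
  rw [h]
  have : (NNReal.pi : ENNReal) = ENNReal.ofReal Real.pi := by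
    rw [← NNReal.coe_real_pi, ENNReal.ofReal_coe_nnreal]
  rw [this]
  simp only [ENNReal.ofReal_one, one_pow, one_mul]
  exact ENNReal.inv_mul_cancel (by simpa using Real.pi_pos) ENNReal.ofReal_ne_top

/-- Mean value inequality for `Ψ(|F| / C)` on a circle. -/
lemma OrliczFunction.le_lintegral_circle (Ψ : OrliczFunction) {F : ℂ → ℂ} {a : ℂ} {r R C : ℝ}
    (hr : 0 < r) (hrR : r < R) (hC : 0 < C) (hF : DifferentiableOn ℂ F (Metric.ball a R)) :
    ENNReal.ofReal (2 * Real.pi) * ENNReal.ofReal (Ψ (‖F a‖ / C)) ≤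
      ∫⁻ θ in Ioo (-Real.pi) Real.pi, ENNReal.ofReal (Ψ (‖F (circleMap a r θ)‖ / C)) := by
  have hπ := Real.pi_pos
  have hmem : ∀ θ, circleMap a r θ ∈ Metric.ball a R := fun θ => by
    have := circleMap_mem_sphere a hr.le θ
    rw [Metric.mem_ball, Metric.mem_sphere.1 this]; exact hrR
  have hcF : Continuous fun θ => F (circleMap a r θ) :=
    hF.continuousOn.comp_continuous (continuous_circleMap a r) hmem
  have hcN : Continuous fun θ => ‖F (circleMap a r θ)‖ / C := hcF.norm.div_const C
  have hcΨ : Continuous fun θ => Ψ (‖F (circleMap a r θ)‖ / C) :=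
    Ψ.continuousOn.comp_continuous hcN fun θ => mem_Ici.2 (by positivity)
  have hint : ∀ {E : Type} [NormedAddCommGroup E] {g : ℝ → E}, Continuous g →
      Integrable g (volume.restrict (Ioo (-Real.pi) Real.pi)) := fun hg =>
    (hg.integrableOn_Icc (a := -Real.pi) (b := Real.pi)).mono_set Ioo_subset_Icc_self
  have hvol : (volume.restrict (Ioo (-Real.pi) Real.pi)).real univ = 2 * Real.pi := by
    rw [Measure.real, Measure.restrict_apply_univ, Real.volume_Ioo,
      ENNReal.toReal_ofReal (by linarith)]
    ring
  have : NeZero (volume.restrict (Ioo (-Real.pi) Real.pi)) := ⟨fun h => by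
    rw [h] at hvol; simp at hvol⟩
  have hmean : F a = ⨍ θ in Ioo (-Real.pi) Real.pi, F (circleMap a r θ) := by
    have h1 : Real.circleAverage F a r = F a := by
      refine DiffContOnCl.circleAverage ?_
      rw [abs_of_pos hr]
      refine DifferentiableOn.diffContOnCl ?_
      rw [closure_ball a hr.ne']
      exact hF.mono (Metric.closedBall_subset_ball hrR)
    -- The average is moved to the angles `(-π, π)`, the range used by polar coordinates.
    rw [← h1, Real.circleAverage_eq_integral_add (-Real.pi),
      intervalIntegral.integral_comp_add_right fun θ => F (circleMap a r θ), average_eq, hvol,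
      intervalIntegral.integral_of_le (by linarith), integral_Ioc_eq_integral_Ioo]
    congr 4
    · ring
    · ring
  -- Jensen's inequality on the circle.
  have hj := Ψ.strictConvexOn'.convexOn.map_average_le (μ := volume.restrict (Ioo (-Real.pi) Real.pi))
    Ψ.continuousOn isClosed_Ici (Eventually.of_forall fun θ => mem_Ici.2 (by positivity))
    (hint hcN) (hint hcΨ)
  have hle : ‖F a‖ / C ≤ ⨍ θ in Ioo (-Real.pi) Real.pi, ‖F (circleMap a r θ)‖ / C := by
    rw [hmean, average_eq, average_eq, integral_div, norm_smul, hvol, smul_eq_mul,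
      Real.norm_of_nonneg (by positivity), mul_div_assoc]
    gcongr
    exact norm_integral_le_integral_norm _
  have hfin : Ψ (‖F a‖ / C) ≤ ⨍ θ in Ioo (-Real.pi) Real.pi, Ψ (‖F (circleMap a r θ)‖ / C) :=
    (Ψ.monotoneOn' (mem_Ici.2 (by positivity))
      (mem_Ici.2 ((show 0 ≤ ‖F a‖ / C by positivity).trans hle)) hle).trans hj
  rw [average_eq, hvol, smul_eq_mul, le_inv_mul_iff₀ (by positivity)] at hfin
  rw [← ENNReal.ofReal_mul (by positivity), ← ofReal_integral_eq_lintegral_ofReal (hint hcΨ)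
    (Eventually.of_forall fun θ => Ψ.nonneg (by positivity))]
  exact ENNReal.ofReal_le_ofReal hfin

/-- Mean value inequality for `Ψ(|F| / C)` on a disk. -/
lemma OrliczFunction.le_lintegral_ball (Ψ : OrliczFunction) {F : ℂ → ℂ} {a : ℂ} {R C : ℝ}
    (hR : 0 ≤ R) (hC : 0 < C) (hF : DifferentiableOn ℂ F (Metric.ball a R)) :
    ENNReal.ofReal (Real.pi * R ^ 2) * ENNReal.ofReal (Ψ (‖F a‖ / C)) ≤
      ∫⁻ z in Metric.ball a R, ENNReal.ofReal (Ψ (‖F z‖ / C)) := by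
  have hπ := Real.pi_pos
  classical
  -- Nothing is known of `F` off the ball. Cutting it off gives global measurability, and `Ψ(0) = 0`
  -- lets the cutoff pass through `Ψ`.
  set G : ℂ → ℂ := (Metric.ball a R).indicator F with hG
  have hGm : Measurable G := by
    rw [hG, ← Set.piecewise_eq_indicator]
    exact hF.continuousOn.measurable_piecewise continuousOn_const measurableSet_ball
  set h : ℂ → ENNReal := fun z => ENNReal.ofReal (Ψ (‖G z‖ / C)) with hh
  have hhm : Measurable h :=
    (Ψ.measurable_comp (hGm.norm.div_const C) fun z => by positivity).ennreal_ofReal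
  have hind : h = (Metric.ball a R).indicator fun z => ENNReal.ofReal (Ψ (‖F z‖ / C)) := by
    funext z
    by_cases hz : z ∈ Metric.ball a R
    · simp [hh, hG, hz]
    · simp [hh, hG, hz, Ψ.map_zero']
  have hvol : ∫⁻ r in Ioo 0 R, ENNReal.ofReal r = ENNReal.ofReal (R ^ 2 / 2) := by
    rw [← ofReal_integral_eq_lintegral_ofReal, ← integral_Ioc_eq_integral_Ioo,
      ← intervalIntegral.integral_of_le hR, integral_id]
    · simp
    · exact (continuous_id.integrableOn_Icc (a := 0) (b := R)).mono_set Ioo_subset_Icc_self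
    · exact (ae_restrict_mem measurableSet_Ioo).mono fun r hr => hr.1.le
  have hsymm : ∀ p : ℝ × ℝ, a + Complex.polarCoord.symm p = circleMap a p.1 p.2 := fun p => by
    rw [Complex.polarCoord_symm_apply, circleMap, Complex.exp_mul_I]
    push_cast; ring
  rw [← lintegral_indicator measurableSet_ball, ← hind, ← lintegral_add_left_eq_self h a,
    ← Complex.lintegral_comp_polarCoord_symm]
  simp only [hsymm, polarCoord_target, smul_eq_mul]
  rw [Measure.volume_eq_prod, ← Measure.prod_restrict, lintegral_prod]
  · calc ENNReal.ofReal (Real.pi * R ^ 2) * ENNReal.ofReal (Ψ (‖F a‖ / C))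
        = ∫⁻ r in Ioo 0 R, ENNReal.ofReal r *
            (ENNReal.ofReal (2 * Real.pi) * ENNReal.ofReal (Ψ (‖F a‖ / C))) := by
          rw [lintegral_mul_const _ ENNReal.measurable_ofReal, hvol, ← mul_assoc]
          congr 1
          rw [← ENNReal.ofReal_mul (by positivity)]
          congr 1
          ring
      _ ≤ ∫⁻ r in Ioo 0 R, ∫⁻ θ in Ioo (-Real.pi) Real.pi,
            ENNReal.ofReal r * h (circleMap a r θ) := by
          refine setLIntegral_mono' measurableSet_Ioo fun r hr => ?_
          rw [lintegral_const_mul' _ _ ENNReal.ofReal_ne_top]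
          gcongr
          refine (Ψ.le_lintegral_circle hr.1 hr.2 hC hF).trans_eq ?_
          refine lintegral_congr fun θ => ?_
          have : circleMap a r θ ∈ Metric.ball a R := by
            rw [Metric.mem_ball, Metric.mem_sphere.1 (circleMap_mem_sphere a hr.1.le θ)]
            exact hr.2
          rw [hind, indicator_of_mem this]
      _ ≤ _ := lintegral_mono_set Ioo_subset_Ioi_self
  · refine Measurable.aemeasurable ?_
    refine (ENNReal.measurable_ofReal.comp measurable_fst).mul (hhm.comp ?_)
    unfold circleMap
    fun_prop

/-- Point evaluations on the Bergman–Orlicz space, modular form. -/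
lemma le_orliczModular (Ψ : OrliczFunction) {f : Disk → ℂ} (hf : Disk.Analytic f) {C : ℝ}
    (hC : 0 < C) (a : Disk) :
    ENNReal.ofReal ((1 - ‖(a : ℂ)‖) ^ 2) * ENNReal.ofReal (Ψ (‖f a‖ / C)) ≤
      orliczModular Ψ f C := by
  obtain ⟨F, hF, hfF⟩ := hf
  have ha := a.norm_lt_one
  have hsub : Metric.ball (a : ℂ) (1 - ‖(a : ℂ)‖) ⊆ Metric.ball 0 1 :=
    Metric.ball_subset_ball' (by simp)
  have h := Ψ.le_lintegral_ball (sub_nonneg.2 ha.le) hC (hF.mono hsub)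
  have hπ : ENNReal.ofReal Real.pi ≠ 0 := by simpa using Real.pi_pos
  unfold orliczModular
  simp only [hfF]
  rw [Disk.lintegral_area fun z => ENNReal.ofReal (Ψ (‖F z‖ / C)), mul_comm _⁻¹,
    ← div_eq_mul_inv, ENNReal.le_div_iff_mul_le (.inl hπ) (.inl ENNReal.ofReal_ne_top)]
  refine le_trans (le_of_eq ?_) (h.trans (lintegral_mono_set hsub))
  rw [ENNReal.ofReal_mul Real.pi_pos.le]
  ring

lemma norm_apply_le (Ψ : OrliczFunction) {f : Disk → ℂ} (hf : Disk.Analytic f) {C : ℝ}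
    (hC : 0 < C) (h : orliczModular Ψ f C ≤ 1) (a : Disk) :
    ‖f a‖ ≤ C * Ψ.inv (1 / (1 - ‖(a : ℂ)‖) ^ 2) := by
  have ha : 0 < 1 - ‖(a : ℂ)‖ := sub_pos.2 a.norm_lt_one
  have h1 := (le_orliczModular Ψ hf hC a).trans h
  rw [← ENNReal.ofReal_mul (by positivity), ENNReal.ofReal_le_one] at h1
  rw [← div_le_iff₀' hC, OrliczFunction.le_inv_iff (by positivity) (by positivity),
    le_div_iff₀' (by positivity)]
  exact h1

/-- Point evaluations on the Bergman–Orlicz space. -/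
lemma BergmanOrlicz.norm_apply_le {Ψ : OrliczFunction} (f : BergmanOrlicz Ψ) (a : Disk) :
    ‖f a‖ ≤ ‖f‖ * Ψ.inv (1 / (1 - ‖(a : ℂ)‖) ^ 2) := by
  have hx : 0 ≤ Ψ.inv (1 / (1 - ‖(a : ℂ)‖) ^ 2) := OrliczFunction.inv_nonneg (by positivity)
  refine le_of_forall_gt_imp_ge_of_dense fun y hy => ?_
  have ha : 0 < 1 - ‖(a : ℂ)‖ := sub_pos.2 a.norm_lt_one
  have hx' : 0 < Ψ.inv (1 / (1 - ‖(a : ℂ)‖) ^ 2) := OrliczFunction.inv_pos (by positivity)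
  rw [← lt_div_iff₀ hx'] at hy
  obtain ⟨C, ⟨hC, hfC⟩, hCy⟩ := exists_lt_of_csInf_lt f.nonempty_set hy
  rw [lt_div_iff₀ hx'] at hCy
  exact (_root_.norm_apply_le Ψ f.2.1 hC hfC a).trans hCy.le

/-! ### Disk automorphisms and test functions -/

lemma Complex.normSq_one_sub_conj_mul_sub (b z : ℂ) :
    Complex.normSq (1 - conj b * z) - Complex.normSq (z - b)
      = (1 - Complex.normSq b) * (1 - Complex.normSq z) := by
  simp [Complex.normSq_apply]
  ring

lemma Complex.one_sub_norm_le_norm_one_sub_conj_mul {b z : ℂ} (hz : ‖z‖ ≤ 1) :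
    1 - ‖b‖ ≤ ‖1 - conj b * z‖ := by
  have h1 := norm_sub_norm_le (1 : ℂ) (conj b * z)
  rw [norm_one, norm_mul, RCLike.norm_conj] at h1
  nlinarith [norm_nonneg b]

lemma Complex.one_sub_conj_mul_ne_zero {b z : ℂ} (hb : ‖b‖ < 1) (hz : ‖z‖ ≤ 1) :
    1 - conj b * z ≠ 0 :=
  norm_pos_iff.1 ((sub_pos.2 hb).trans_le (one_sub_norm_le_norm_one_sub_conj_mul hz))

/-- The area of the image of the disk under a disk automorphism, as an integral of the Jacobian. -/
lemma lintegral_mobius_jacobian_le {b : ℂ} (hb : ‖b‖ < 1) :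
    ∫⁻ z : Disk, ENNReal.ofReal (((1 - ‖b‖ ^ 2) / ‖1 - conj b * (z : ℂ)‖ ^ 2) ^ 2) ∂Disk.area
      ≤ 1 := by
  have hne : ∀ z ∈ Metric.ball (0 : ℂ) 1, 1 - conj b * z ≠ 0 := fun z hz =>
    Complex.one_sub_conj_mul_ne_zero hb (mem_ball_zero_iff.1 hz).le
  have hb2 : ‖b‖ ^ 2 < 1 := by nlinarith [norm_nonneg b]
  have hbC : (1 : ℂ) - conj b * b ≠ 0 := Complex.one_sub_conj_mul_ne_zero hb hb.le
  set M : ℂ → ℂ := fun z => (z - b) / (1 - conj b * z) with hM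
  set M' : ℂ → ℂ := fun z => (1 - conj b * b) / (1 - conj b * z) ^ 2 with hM'
  have hderiv : ∀ z ∈ Metric.ball (0 : ℂ) 1, HasDerivAt M (M' z) z := fun z hz => by
    have h := ((hasDerivAt_id z).sub_const b).div
      (((hasDerivAt_id z).const_mul (conj b)).const_sub 1) (hne z hz)
    convert! h using 1
    simp only [hM', id]
    congr 1
    ring
  have hinj : InjOn M (Metric.ball 0 1) := by
    intro z hz w hw h
    simp only [hM] at h
    rw [div_eq_div_iff (hne z hz) (hne w hw)] at h
    have : (1 - conj b * b) * (z - w) = 0 := by linear_combination h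
    exact sub_eq_zero.1 ((mul_eq_zero.1 this).resolve_left hbC)
  have hmaps : M '' Metric.ball 0 1 ⊆ Metric.ball 0 1 := by
    rintro _ ⟨z, hz, rfl⟩
    have hz1 := mem_ball_zero_iff.1 hz
    rw [mem_ball_zero_iff, hM, norm_div, div_lt_one (norm_pos_iff.2 (hne z hz))]
    refine lt_of_pow_lt_pow_left₀ 2 (norm_nonneg _) ?_
    have h := Complex.normSq_one_sub_conj_mul_sub b z
    simp only [Complex.normSq_eq_norm_sq] at h
    have hz2 : ‖z‖ ^ 2 < 1 := by nlinarith [norm_nonneg z]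
    nlinarith [mul_pos (sub_pos.2 hb2) (sub_pos.2 hz2)]
  -- The real Jacobian of a holomorphic map is `|M'|²`. Injectivity and `M(𝔻) ⊆ 𝔻` suffice for the
  -- upper bound.
  have key := lintegral_abs_det_fderiv_eq_addHaar_image volume measurableSet_ball
    (fun z hz => ((hderiv z hz).hasFDerivAt.restrictScalars ℝ).hasFDerivWithinAt) hinj
  rw [Disk.lintegral_area fun z =>
    ENNReal.ofReal (((1 - ‖b‖ ^ 2) / ‖1 - conj b * z‖ ^ 2) ^ 2)]
  have hnorm : ‖(1 : ℂ) - conj b * b‖ = 1 - ‖b‖ ^ 2 := by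
    rw [← Complex.normSq_eq_conj_mul_self, ← Complex.ofReal_one, ← Complex.ofReal_sub,
      Complex.norm_of_nonneg (by rw [Complex.normSq_eq_norm_sq]; linarith),
      Complex.normSq_eq_norm_sq]
  have hle : ∫⁻ z in Metric.ball (0 : ℂ) 1,
      ENNReal.ofReal (((1 - ‖b‖ ^ 2) / ‖1 - conj b * z‖ ^ 2) ^ 2)
      ≤ volume (Metric.ball (0 : ℂ) 1) := by
    refine le_trans (le_of_eq ?_) (key.trans_le (measure_mono hmaps))
    refine lintegral_congr fun z => ?_
    congr 1
    simp [ContinuousLinearMap.det, LinearMap.det_restrictScalars, Algebra.norm_complex_eq,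
      Complex.normSq_eq_norm_sq, hM', hnorm, div_pow]
    exact (abs_of_nonneg (by positivity)).symm
  calc _ ≤ (ENNReal.ofReal Real.pi)⁻¹ * volume (Metric.ball (0 : ℂ) 1) := by gcongr
    _ = 1 := by
      have h := Disk.lintegral_area 1
      simpa [Disk.area_univ] using h.symm

/-- A bounded function peaking at `b`, with `L¹`-norm of order `(1 - |b|)²`. -/
noncomputable def bergmanPeak (b : Disk) (z : Disk) : ℂ :=
  ((1 - ‖(b : ℂ)‖ : ℝ) / (1 - conj (b : ℂ) * z)) ^ 4

lemma norm_bergmanPeak (b z : Disk) :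
    ‖bergmanPeak b z‖ = ((1 - ‖(b : ℂ)‖) / ‖1 - conj (b : ℂ) * z‖) ^ 4 := by
  rw [bergmanPeak, norm_pow, norm_div, Complex.norm_of_nonneg (sub_nonneg.2 b.norm_lt_one.le)]

lemma norm_bergmanPeak_le_one (b z : Disk) : ‖bergmanPeak b z‖ ≤ 1 := by
  have hb := sub_pos.2 b.norm_lt_one
  have h := Complex.one_sub_norm_le_norm_one_sub_conj_mul (b := b) z.norm_lt_one.le
  rw [norm_bergmanPeak]
  exact pow_le_one₀ (by positivity) ((div_le_one (hb.trans_le h)).2 h)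

lemma norm_bergmanPeak_le (b z : Disk) :
    ‖bergmanPeak b z‖ ≤ ((1 - ‖(b : ℂ)‖) / (1 - ‖(z : ℂ)‖)) ^ 4 := by
  have hb := sub_pos.2 b.norm_lt_one
  have hz := sub_pos.2 z.norm_lt_one
  have h1 := norm_sub_norm_le (1 : ℂ) (conj (b : ℂ) * z)
  rw [norm_one, norm_mul, RCLike.norm_conj] at h1
  have h2 := mul_le_of_le_one_left (norm_nonneg (z : ℂ)) b.norm_lt_one.le
  rw [norm_bergmanPeak]
  gcongr
  linarith

/-- `1 - |b|² ≤ 2 (1 - |b|)`, raised to the fourth power. -/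
lemma le_norm_bergmanPeak_self (b : Disk) : 1 / 16 ≤ ‖bergmanPeak b b‖ := by
  have hb := sub_pos.2 b.norm_lt_one
  have hb0 := norm_nonneg (b : ℂ)
  have hn : ‖(1 : ℂ) - conj (b : ℂ) * b‖ = (1 - ‖(b : ℂ)‖) * (1 + ‖(b : ℂ)‖) := by
    rw [← Complex.normSq_eq_conj_mul_self, ← Complex.ofReal_one, ← Complex.ofReal_sub,
      Complex.norm_of_nonneg, Complex.normSq_eq_norm_sq]
    · ring
    · rw [Complex.normSq_eq_norm_sq]; nlinarith
  rw [norm_bergmanPeak, hn, div_mul_eq_div_div, div_self hb.ne']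
  calc (1 / 16 : ℝ) = (1 / 2) ^ 4 := by norm_num
    _ ≤ _ := by
      gcongr
      linarith

lemma analytic_bergmanPeak (b : Disk) : Disk.Analytic (bergmanPeak b) := by
  refine ⟨fun z => ((1 - ‖(b : ℂ)‖ : ℝ) / (1 - conj (b : ℂ) * z)) ^ 4, ?_, fun z => rfl⟩
  refine DifferentiableOn.pow (DifferentiableOn.div (by fun_prop) (by fun_prop) fun z hz => ?_) 4
  exact Complex.one_sub_conj_mul_ne_zero b.norm_lt_one (mem_ball_zero_iff.1 hz).le

/-- Since `1 - |b| ≤ 1 - |b|²`, the modulus of the peak is at most `(1 - |b|)²` times the Jacobian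
of a disk automorphism. -/
lemma lintegral_norm_bergmanPeak_le (b : Disk) :
    ∫⁻ z, ENNReal.ofReal ‖bergmanPeak b z‖ ∂Disk.area
      ≤ ENNReal.ofReal ((1 - ‖(b : ℂ)‖) ^ 2) := by
  have hb := sub_pos.2 b.norm_lt_one
  have hb0 := norm_nonneg (b : ℂ)
  calc _ ≤ ∫⁻ z : Disk, ENNReal.ofReal ((1 - ‖(b : ℂ)‖) ^ 2) * ENNReal.ofReal
        (((1 - ‖(b : ℂ)‖ ^ 2) / ‖1 - conj (b : ℂ) * (z : ℂ)‖ ^ 2) ^ 2) ∂Disk.area := by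
        refine lintegral_mono fun z => ?_
        rw [← ENNReal.ofReal_mul (by positivity), norm_bergmanPeak]
        refine ENNReal.ofReal_le_ofReal ?_
        rw [div_pow, div_pow, ← pow_mul, ← mul_div_assoc]
        gcongr
        calc (1 - ‖(b : ℂ)‖) ^ 4 = (1 - ‖(b : ℂ)‖) ^ 2 * (1 - ‖(b : ℂ)‖) ^ 2 := by ring
          _ ≤ (1 - ‖(b : ℂ)‖) ^ 2 * (1 - ‖(b : ℂ)‖ ^ 2) ^ 2 := by
            gcongr
            nlinarith
    _ = ENNReal.ofReal ((1 - ‖(b : ℂ)‖) ^ 2) * _ :=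
        lintegral_const_mul' _ _ ENNReal.ofReal_ne_top
    _ ≤ ENNReal.ofReal ((1 - ‖(b : ℂ)‖) ^ 2) * 1 := by
        gcongr
        exact lintegral_mobius_jacobian_le b.norm_lt_one
    _ = _ := mul_one _

/-- The function `Ψ⁻¹(1 / (1 - |b|)²) · bergmanPeak b`. -/
noncomputable def bergmanTest (Ψ : OrliczFunction) (b : Disk) : Disk → ℂ :=
  ((Ψ.inv (1 / (1 - ‖(b : ℂ)‖) ^ 2) : ℝ) : ℂ) • bergmanPeak b

lemma norm_bergmanTest (Ψ : OrliczFunction) (b z : Disk) :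
    ‖bergmanTest Ψ b z‖ = Ψ.inv (1 / (1 - ‖(b : ℂ)‖) ^ 2) * ‖bergmanPeak b z‖ := by
  rw [bergmanTest, Pi.smul_apply, smul_eq_mul, norm_mul,
    Complex.norm_of_nonneg (OrliczFunction.inv_nonneg (by positivity))]

lemma orliczModular_bergmanTest_le (Ψ : OrliczFunction) (b : Disk) :
    orliczModular Ψ (bergmanTest Ψ b) 1 ≤ 1 := by
  have hb := sub_pos.2 b.norm_lt_one
  have ht : 0 ≤ 1 / (1 - ‖(b : ℂ)‖) ^ 2 := by positivity
  calc _ ≤ ∫⁻ z, ENNReal.ofReal (1 / (1 - ‖(b : ℂ)‖) ^ 2)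
        * ENNReal.ofReal ‖bergmanPeak b z‖ ∂Disk.area := by
        refine lintegral_mono fun z => ?_
        rw [← ENNReal.ofReal_mul ht, div_one, norm_bergmanTest]
        refine ENNReal.ofReal_le_ofReal ?_
        have h := Ψ.le_mul (OrliczFunction.inv_nonneg (Ψ := Ψ) ht)
          (norm_nonneg (bergmanPeak b z)) (norm_bergmanPeak_le_one b z)
        rwa [OrliczFunction.apply_inv ht, mul_comm, mul_comm ‖_‖ (1 / _)] at h
    _ = ENNReal.ofReal (1 / (1 - ‖(b : ℂ)‖) ^ 2) * _ :=
        lintegral_const_mul' _ _ ENNReal.ofReal_ne_top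
    _ ≤ ENNReal.ofReal (1 / (1 - ‖(b : ℂ)‖) ^ 2) * ENNReal.ofReal ((1 - ‖(b : ℂ)‖) ^ 2) := by
        gcongr
        exact lintegral_norm_bergmanPeak_le b
    _ = 1 := by
        rw [← ENNReal.ofReal_mul ht, one_div_mul_cancel (by positivity), ENNReal.ofReal_one]

/-- Gives decay to `0` at fixed `z` as `|b| → 1`: of the four powers of `1 - |b|` in the peak, the
factor `Ψ⁻¹` costs at most two. -/
lemma norm_bergmanTest_le (Ψ : OrliczFunction) (b z : Disk) :
    ‖bergmanTest Ψ b z‖ ≤ Ψ.inv 1 / (1 - ‖(z : ℂ)‖) ^ 4 * (1 - ‖(b : ℂ)‖) ^ 2 := by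
  have hb := sub_pos.2 b.norm_lt_one
  have hz := sub_pos.2 z.norm_lt_one
  have hb1 : (1 - ‖(b : ℂ)‖) ^ 2 ≤ 1 :=
    pow_le_one₀ hb.le (by linarith [norm_nonneg (b : ℂ)])
  have h1 : 0 ≤ Ψ.inv 1 := OrliczFunction.inv_nonneg zero_le_one
  have h2 : Ψ.inv (1 / (1 - ‖(b : ℂ)‖) ^ 2) ≤ Ψ.inv 1 * (1 / (1 - ‖(b : ℂ)‖) ^ 2) :=
    OrliczFunction.inv_le_mul (by rw [le_div_iff₀ (by positivity)]; linarith)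
  rw [norm_bergmanTest]
  calc _ ≤ Ψ.inv 1 * (1 / (1 - ‖(b : ℂ)‖) ^ 2) * ((1 - ‖(b : ℂ)‖) / (1 - ‖(z : ℂ)‖)) ^ 4 := by
        gcongr
        exact norm_bergmanPeak_le b z
    _ = _ := by field_simp

/-- `bergmanTest` as an element of the Bergman–Orlicz space. -/
noncomputable def BergmanOrlicz.test (Ψ : OrliczFunction) (b : Disk) : BergmanOrlicz Ψ :=
  ⟨bergmanTest Ψ b, by
    obtain ⟨F, hF, h⟩ := analytic_bergmanPeak b
    exact ⟨((Ψ.inv (1 / (1 - ‖(b : ℂ)‖) ^ 2) : ℝ) : ℂ) • F, hF.const_smul _,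
      fun z => by simp [bergmanTest, h]⟩,
    1, one_pos, (orliczModular_bergmanTest_le Ψ b).trans_lt ENNReal.one_lt_top⟩

lemma BergmanOrlicz.norm_le_of_modular {Ψ : OrliczFunction} (f : BergmanOrlicz Ψ) {C : ℝ}
    (hC : 0 < C) (h : orliczModular Ψ f C ≤ 1) : ‖f‖ ≤ C :=
  csInf_le (luxemburgNorm_bddBelow Ψ _) ⟨hC, h⟩

/-! ### Approach to the boundary and necessity of the condition -/

/-- The filter of the points of the disk approaching the unit circle. -/
noncomputable def Disk.boundaryFilter : Filter Disk := comap (fun a : Disk => ‖(a : ℂ)‖) (𝓝[<] 1)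

lemma Disk.tendsto_one_sub_norm :
    Tendsto (fun a : Disk => 1 - ‖(a : ℂ)‖) Disk.boundaryFilter (𝓝 0) := by
  have h : Tendsto (fun a : Disk => ‖(a : ℂ)‖) Disk.boundaryFilter (𝓝 1) :=
    tendsto_comap.mono_right nhdsWithin_le_nhds
  simpa using h.const_sub 1

lemma Disk.eventually_boundaryFilter {p : Disk → Prop} :
    (∀ᶠ a in Disk.boundaryFilter, p a) ↔ ∃ ρ < 1, ∀ a : Disk, ρ < ‖(a : ℂ)‖ → p a := by
  constructor
  · intro h
    rw [Disk.boundaryFilter, eventually_comap] at h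
    obtain ⟨ρ, hρ, hs⟩ := mem_nhdsLT_iff_exists_Ioo_subset.1 h
    exact ⟨ρ, hρ, fun a ha => hs ⟨ha, a.norm_lt_one⟩ a rfl⟩
  · rintro ⟨ρ, hρ, h⟩
    have h1 : ∀ᶠ a : Disk in Disk.boundaryFilter, 1 - ‖(a : ℂ)‖ < 1 - ρ :=
      Disk.tendsto_one_sub_norm.eventually_lt_const (by linarith)
    exact h1.mono fun a ha => h a (by linarith)

lemma OrliczFunction.tendsto_inv_boundary (Ψ : OrliczFunction) :
    Tendsto (fun a : Disk => Ψ.inv (1 / (1 - ‖(a : ℂ)‖) ^ 2)) Disk.boundaryFilter atTop := by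
  refine OrliczFunction.tendsto_inv_atTop.comp ?_
  have h0 : Tendsto (fun a : Disk => (1 - ‖(a : ℂ)‖) ^ 2) Disk.boundaryFilter (𝓝[>] 0) := by
    refine tendsto_nhdsWithin_iff.2 ⟨by simpa using Disk.tendsto_one_sub_norm.pow 2,
      Eventually.of_forall fun a => ?_⟩
    have := sub_pos.2 a.norm_lt_one
    exact mem_Ioi.2 (by positivity)
  simp only [one_div]
  exact h0.inv_tendsto_nhdsGT_zero

/-- The images stay in a compact set, so it suffices that `0` is the only cluster point. Point
evaluations are continuous, and the images tend to `0` pointwise. -/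
lemma tendsto_norm_map_test {Ψ : OrliczFunction} {φ : Disk → Disk}
    {T : BergmanOrlicz Ψ →L[ℂ] BergmanOrlicz Ψ}
    (hT : ∀ (f : BergmanOrlicz Ψ) (z : Disk), T f z = f (φ z)) (hc : IsCompactOperator T) :
    Tendsto (fun b => T (BergmanOrlicz.test Ψ b)) Disk.boundaryFilter (𝓝 0) := by
  obtain ⟨K, hK, hKT⟩ := hc.image_closedBall_subset_compact 1
  refine hK.tendsto_nhds_of_unique_mapClusterPt (Eventually.of_forall fun b => hKT
    ⟨_, mem_closedBall_zero_iff.2 (BergmanOrlicz.norm_le_of_modular _ one_pos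
      (orliczModular_bergmanTest_le Ψ b)), rfl⟩) fun g _ hg => ?_
  refine Subtype.ext (funext fun z => ?_)
  have hz := sub_pos.2 z.norm_lt_one
  have hcont : Continuous fun g : BergmanOrlicz Ψ => g z := by
    let e : BergmanOrlicz Ψ →ₗ[ℂ] ℂ :=
      { toFun := fun g => g z, map_add' := fun _ _ => rfl, map_smul' := fun _ _ => rfl }
    exact (e.mkContinuous (Ψ.inv (1 / (1 - ‖(z : ℂ)‖) ^ 2)) fun g =>
      (g.norm_apply_le z).trans_eq (mul_comm _ _)).continuous
  have h1 := hg.continuousAt_comp hcont.continuousAt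
  have h2 : Tendsto ((fun g : BergmanOrlicz Ψ => g z) ∘ fun b => T (BergmanOrlicz.test Ψ b))
      Disk.boundaryFilter (𝓝 0) := by
    refine squeeze_zero_norm (fun b => ?_) ((Disk.tendsto_one_sub_norm.pow 2).const_mul
      (Ψ.inv 1 / (1 - ‖(φ z : ℂ)‖) ^ 4) |>.trans (by simp))
    simp only [Function.comp, hT]
    exact norm_bergmanTest_le Ψ b (φ z)
  exact eq_of_nhds_neBot (h1.clusterPt.mono h2)

theorem IsCompactCompositionOperator.bergmanCompactCondition {Ψ : OrliczFunction}
    {φ : Disk → Disk} (h : IsCompactCompositionOperator Ψ φ) : BergmanCompactCondition Ψ φ := by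
  obtain ⟨T, hT, hc⟩ := h
  have hpos : ∀ a : Disk, 0 < Ψ.inv (1 / (1 - ‖(a : ℂ)‖) ^ 2) := fun a =>
    OrliczFunction.inv_pos (by have := sub_pos.2 a.norm_lt_one; positivity)
  have hle : ∀ a : Disk, Ψ.inv (1 / (1 - ‖(φ a : ℂ)‖) ^ 2) ≤
      16 * ‖T (BergmanOrlicz.test Ψ (φ a))‖ * Ψ.inv (1 / (1 - ‖(a : ℂ)‖) ^ 2) := fun a => by
    have h1 := (T (BergmanOrlicz.test Ψ (φ a))).norm_apply_le a
    rw [hT] at h1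
    have h2 : ‖BergmanOrlicz.test Ψ (φ a) (φ a)‖ = _ := norm_bergmanTest Ψ (φ a) (φ a)
    rw [h2] at h1
    have h3 := mul_le_mul_of_nonneg_left (le_norm_bergmanPeak_self (φ a)) (hpos (φ a)).le
    linarith
  refine Metric.tendsto_nhds.2 fun ε hε => ?_
  obtain ⟨ρ, hρ, hρε⟩ := Disk.eventually_boundaryFilter.1
    ((tendsto_norm_map_test hT hc).norm.eventually_lt_const
      (show ‖(0 : BergmanOrlicz Ψ)‖ < ε / 16 by rw [norm_zero]; positivity))
  filter_upwards [Ψ.tendsto_inv_boundary.eventually_gt_atTop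
    (Ψ.inv (1 / (1 - ρ) ^ 2) / ε)] with a ha
  rw [Real.dist_eq, sub_zero, abs_of_nonneg (div_nonneg (hpos _).le (hpos _).le),
    div_lt_iff₀ (hpos a)]
  -- `φ(a)` need not approach the circle. Where it stays in `|w| ≤ ρ`, the numerator is bounded
  -- while the denominator tends to infinity.
  rcases lt_or_ge ρ ‖(φ a : ℂ)‖ with hφ | hφ
  · refine (hle a).trans_lt (mul_lt_mul_of_pos_right ?_ (hpos a))
    linarith [hρε (φ a) hφ]
  · rw [div_lt_iff₀' hε] at ha
    refine (OrliczFunction.inv_le_inv (by positivity) ?_).trans_lt ha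
    have := sub_pos.2 (φ a).norm_lt_one
    gcongr

/-! ### Normal families and auxiliary facts on the disk -/

/-- A locally bounded, pointwise convergent family of analytic functions on the disk converges
uniformly on smaller disks. -/
lemma tendstoUniformlyOn_of_pointwise {ι : Type*} {l : Filter ι} {F : ι → ℂ → ℂ} {f : ℂ → ℂ}
    {B : ℝ → ℝ} (hF : ∀ i, DifferentiableOn ℂ (F i) (Metric.ball 0 1))
    (hB : ∀ i, ∀ r < 1, ∀ z, ‖z‖ ≤ r → ‖F i z‖ ≤ B r)
    (hlim : ∀ z ∈ Metric.ball (0 : ℂ) 1, Tendsto (fun i => F i z) l (𝓝 (f z)))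
    {ρ : ℝ} (hρ : ρ < 1) : TendstoUniformlyOn F f l (Metric.closedBall 0 ρ) := by
  have hsub : Metric.closedBall (0 : ℂ) ρ ⊆ Metric.ball 0 1 := Metric.closedBall_subset_ball hρ
  have heq : EquicontinuousOn F (Metric.closedBall 0 ρ) := by
    intro z₀ hz₀
    refine EquicontinuousAt.equicontinuousWithinAt ?_ _
    have hz : ‖z₀‖ ≤ ρ := mem_closedBall_zero_iff.1 hz₀
    set s := (1 - ρ) / 2 with hs
    have hs0 : 0 < s := by linarith
    have hball : ∀ z ∈ Metric.ball z₀ s, ‖z‖ ≤ ρ + s := fun z hz' => by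
      have h1 := norm_le_norm_add_norm_sub' z z₀
      rw [mem_ball_iff_norm] at hz'
      linarith
    have hrs : ρ + s < 1 := by linarith
    -- The Schwarz lemma: on the ball of radius `s` about `z₀`, `F i` stays within `2 B (ρ + s)` of
    -- `F i z₀`.
    refine Metric.equicontinuousAt_of_continuity_modulus
      (fun z => 2 * B (ρ + s) / s * dist z z₀) ?_ F ?_
    · have : Continuous fun z => 2 * B (ρ + s) / s * dist z z₀ := by fun_prop
      simpa using this.tendsto z₀
    · filter_upwards [Metric.ball_mem_nhds z₀ hs0] with z hz' i
      rw [dist_comm]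
      refine Complex.dist_le_div_mul_dist_of_mapsTo_ball
        ((hF i).mono fun w hw => mem_ball_zero_iff.2 ((hball w hw).trans_lt hrs)) ?_ hz'
      intro w hw
      rw [mem_closedBall_iff_norm]
      have h1 := hB i _ hrs w (hball w hw)
      have h2 := hB i _ hrs z₀ (by linarith)
      linarith [norm_sub_le (F i w) (F i z₀)]
  have h := (EquicontinuousOn.tendsto_uniformOnFun_iff_pi' (𝔖 := {Metric.closedBall (0 : ℂ) ρ})
    (fun K hK => by rw [mem_singleton_iff.1 hK]; exact isCompact_closedBall 0 ρ)
    (fun K hK => by rw [mem_singleton_iff.1 hK]; exact heq) l f).2 (by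
      refine tendsto_pi_nhds.2 fun z => ?_
      have hz : (z : ℂ) ∈ Metric.closedBall (0 : ℂ) ρ := by simpa only [mem_sUnion,
        mem_singleton_iff, exists_eq_left] using z.2
      exact hlim z (hsub hz))
  rw [UniformOnFun.tendsto_iff_tendstoUniformlyOn] at h
  exact h _ rfl

namespace Disk

/-- Extension of a function on the disk by zero. -/
noncomputable def extend (f : Disk → ℂ) (z : ℂ) : ℂ :=
  open Classical in if h : z ∈ Metric.ball (0 : ℂ) 1 then f ⟨z, h⟩ else 0

lemma extend_of_mem (f : Disk → ℂ) {z : ℂ} (h : z ∈ Metric.ball (0 : ℂ) 1) :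
    extend f z = f ⟨z, h⟩ := dif_pos h

@[simp] lemma extend_coe (f : Disk → ℂ) (z : Disk) : extend f z = f z := extend_of_mem f z.2

lemma analytic_iff {f : Disk → ℂ} :
    Analytic f ↔ DifferentiableOn ℂ (extend f) (Metric.ball 0 1) := by
  refine ⟨fun ⟨F, hF, h⟩ => hF.congr fun z hz => ?_, fun h => ⟨_, h, fun z => by simp⟩⟩
  rw [extend_of_mem f hz, h]

lemma Analytic.comp {f : Disk → ℂ} {φ : Disk → Disk} (hf : Analytic f)
    (hφ : Analytic fun z => (φ z : ℂ)) : Analytic (f ∘ φ) := by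
  obtain ⟨F, hF, h⟩ := hf
  obtain ⟨Φ, hΦ, hφΦ⟩ := hφ
  refine ⟨F ∘ Φ, hF.comp hΦ fun z hz => ?_, fun z => ?_⟩
  · rw [← hφΦ ⟨z, hz⟩]; exact (φ _).2
  · rw [Function.comp, Function.comp, h, ← hφΦ]

lemma exists_norm_le_of_norm_le {φ : Disk → Disk} (hφ : Analytic fun z => (φ z : ℂ)) {ρ : ℝ}
    (hρ : ρ < 1) : ∃ σ < 1, ∀ z : Disk, ‖(z : ℂ)‖ ≤ ρ → ‖(φ z : ℂ)‖ ≤ σ := by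
  -- The maximum with `0` keeps this set nonempty when `ρ < 0`.
  have hK : IsCompact ((Subtype.val : Disk → ℂ) ⁻¹' Metric.closedBall 0 (max ρ 0)) := by
    refine IsInducing.subtypeVal.isCompact_preimage' (isCompact_closedBall _ _) ?_
    rw [Subtype.range_coe]
    exact Metric.closedBall_subset_ball (max_lt hρ one_pos)
  obtain ⟨w, -, hw⟩ := hK.exists_isMaxOn ⟨⟨0, by simp⟩, by simp⟩ hφ.continuous.norm.continuousOn
  exact ⟨‖(φ w : ℂ)‖, (φ w).norm_lt_one, fun z hz => hw
    (mem_preimage.2 (mem_closedBall_zero_iff.2 (hz.trans (le_max_left _ _))))⟩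

/-- In polar coordinates this is the convergence of `∫₀¹ y (1 - y)^(-1/2) dy`. -/
lemma lintegral_one_sub_norm_rpow_lt_top :
    ∫⁻ z : Disk, ENNReal.ofReal ((1 - ‖(z : ℂ)‖) ^ (-1 / 2 : ℝ)) ∂area < ⊤ := by
  have h1 : IntervalIntegrable (fun y : ℝ => y * (1 - y) ^ (-1 / 2 : ℝ)) volume 0 1 := by
    have h := (intervalIntegral.intervalIntegrable_rpow' (a := 0) (b := 1)
      (r := -1 / 2) (by norm_num)).comp_sub_left 1
    simp only [sub_zero, sub_self] at h
    exact h.symm.continuousOn_mul continuousOn_id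
  have h2 : IntegrableOn (fun z : ℂ => (1 - ‖z‖) ^ (-1 / 2 : ℝ)) (Metric.ball 0 1) := by
    refine (integrableOn_fun_norm_addHaar volume
      (f := fun y : ℝ => (1 - y) ^ (-1 / 2 : ℝ)) (r := 1)).2 ?_
    rw [intervalIntegrable_iff_integrableOn_Ioo_of_le zero_le_one] at h1
    simpa [Complex.finrank_real_complex] using h1
  rw [lintegral_area fun z => ENNReal.ofReal ((1 - ‖z‖) ^ (-1 / 2 : ℝ))]
  refine ENNReal.mul_lt_top (by simpa using Real.pi_pos) ?_
  exact h2.lintegral_lt_top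

end Disk

/-! ### The modular estimate under `Δ²` -/

/-- Under the `Δ²` condition, `Ψ(Ψ⁻¹(1 / (1 - |z|)²) / α²) ≤ (1 - |z|)^{-1/2}` near the boundary. -/
lemma OrliczFunction.DeltaSq.exists_le_rpow {Ψ : OrliczFunction} (h : Ψ.DeltaSq) :
    ∃ β > 0, ∀ᶠ z : Disk in Disk.boundaryFilter,
      Ψ (β * Ψ.inv (1 / (1 - ‖(z : ℂ)‖) ^ 2)) ≤ (1 - ‖(z : ℂ)‖) ^ (-1 / 2 : ℝ) := by
  obtain ⟨α, hα, hΔ⟩ := h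
  obtain ⟨x₀, hx₀⟩ := eventually_atTop.1 hΔ
  have hα0 : 0 < α := one_pos.trans hα
  refine ⟨(α ^ 2)⁻¹, by positivity, ?_⟩
  filter_upwards [Ψ.tendsto_inv_boundary.eventually_ge_atTop (α ^ 2 * max x₀ 0)] with z hz
  have hz1 := sub_pos.2 z.norm_lt_one
  set s := Ψ.inv (1 / (1 - ‖(z : ℂ)‖) ^ 2) with hs
  have hΨs : Ψ s = 1 / (1 - ‖(z : ℂ)‖) ^ 2 := apply_inv (by positivity)
  have hx : max x₀ 0 ≤ (α ^ 2)⁻¹ * s := by rwa [le_inv_mul_iff₀ (by positivity)]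
  have hx0 : 0 ≤ (α ^ 2)⁻¹ * s := (le_max_right _ _).trans hx
  have h1 := hx₀ _ ((le_max_left _ _).trans hx)
  -- Using `Δ²` at `s / α²` and at `s / α` gives `Ψ(s / α²)⁴ ≤ Ψ(s)`.
  have h2 := hx₀ (α * ((α ^ 2)⁻¹ * s)) (((le_max_left _ _).trans hx).trans
    (le_mul_of_one_le_left hx0 hα.le))
  rw [show α * (α * ((α ^ 2)⁻¹ * s)) = s by field_simp, hΨs] at h2
  refine le_of_pow_le_pow_left₀ (n := 4) (by norm_num) (by positivity) ?_
  calc Ψ ((α ^ 2)⁻¹ * s) ^ 4 = (Ψ ((α ^ 2)⁻¹ * s) ^ 2) ^ 2 := by ring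
    _ ≤ Ψ (α * ((α ^ 2)⁻¹ * s)) ^ 2 := by gcongr
    _ ≤ 1 / (1 - ‖(z : ℂ)‖) ^ 2 := h2
    _ = _ := by
      rw [← Real.rpow_natCast (_ ^ (-1 / 2 : ℝ)), ← Real.rpow_mul hz1.le, one_div,
        ← Real.rpow_natCast, ← Real.rpow_neg hz1.le]
      norm_num

/-- The quantitative core of sufficiency. The factor `2` allows `h` to be a difference of two
members of `growthClass Ψ`. -/
lemma exists_orliczModular_comp_le_one {Ψ : OrliczFunction} {φ : Disk → Disk}
    (hφ : Disk.Analytic fun z => (φ z : ℂ)) (hΔ : Ψ.DeltaSq) (hc : BergmanCompactCondition Ψ φ)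
    {η : ℝ} (hη : 0 < η) :
    ∃ σ < 1, ∃ δ > 0, ∀ h : Disk → ℂ,
      (∀ w : Disk, ‖h w‖ ≤ 2 * Ψ.inv (1 / (1 - ‖(w : ℂ)‖) ^ 2)) →
      (∀ w : Disk, ‖(w : ℂ)‖ ≤ σ → ‖h w‖ ≤ δ) → orliczModular Ψ (h ∘ φ) η ≤ 1 := by
  obtain ⟨β, hβ, hβz⟩ := hΔ.exists_le_rpow
  have hpos : ∀ a : Disk, 0 < Ψ.inv (1 / (1 - ‖(a : ℂ)‖) ^ 2) := fun a =>
    OrliczFunction.inv_pos (by have := sub_pos.2 a.norm_lt_one; positivity)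
  set W := (∫⁻ z : Disk, ENNReal.ofReal ((1 - ‖(z : ℂ)‖) ^ (-1 / 2 : ℝ)) ∂Disk.area).toReal with hW
  have hW0 : 0 ≤ W := ENNReal.toReal_nonneg
  have hWe : ∫⁻ z : Disk, ENNReal.ofReal ((1 - ‖(z : ℂ)‖) ^ (-1 / 2 : ℝ)) ∂Disk.area
      = ENNReal.ofReal W :=
    (ENNReal.ofReal_toReal Disk.lintegral_one_sub_norm_rpow_lt_top.ne).symm
  -- Chosen so that the boundary part contributes `κ W ≤ 1 / 2`. The interior part contributes at
  -- most `1 / 2` through `δ = η Ψ⁻¹(1 / 2)`.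
  set κ := 1 / (2 * (W + 1)) with hκ
  have hκ0 : 0 < κ := by positivity
  have hκ1 : κ ≤ 1 := by rw [hκ, div_le_one (by positivity)]; linarith
  have hκW : κ * W ≤ 1 / 2 := by
    rw [hκ, one_div_mul_eq_div, div_le_iff₀ (by positivity)]; linarith
  have hev : ∀ᶠ z in Disk.boundaryFilter, _ := hc.eventually_lt_const
    (show 0 < η * κ * β / 2 by positivity)
  obtain ⟨ρ, hρ, hρz⟩ := Disk.eventually_boundaryFilter.1 (hβz.and hev)
  obtain ⟨σ, hσ, hσz⟩ := Disk.exists_norm_le_of_norm_le hφ hρ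
  have hhalf : 0 < Ψ.inv (1 / 2) := OrliczFunction.inv_pos (by norm_num)
  refine ⟨σ, hσ, η * Ψ.inv (1 / 2), by positivity, fun h hh hhσ => ?_⟩
  have hpt : ∀ z : Disk, Ψ (‖h (φ z)‖ / η) ≤ 1 / 2 + κ * (1 - ‖(z : ℂ)‖) ^ (-1 / 2 : ℝ) := by
    intro z
    have hz1 := sub_pos.2 z.norm_lt_one
    rcases lt_or_ge ρ ‖(z : ℂ)‖ with hz | hz
    · obtain ⟨hz2, hz3⟩ := hρz z hz
      rw [div_lt_iff₀ (hpos z)] at hz3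
      have h1 : ‖h (φ z)‖ / η ≤ κ * (β * Ψ.inv (1 / (1 - ‖(z : ℂ)‖) ^ 2)) := by
        rw [div_le_iff₀ hη]
        linarith [hh (φ z)]
      have hβs : 0 ≤ β * Ψ.inv (1 / (1 - ‖(z : ℂ)‖) ^ 2) := (mul_pos hβ (hpos z)).le
      calc _ ≤ Ψ (κ * (β * Ψ.inv (1 / (1 - ‖(z : ℂ)‖) ^ 2))) :=
            Ψ.monotoneOn' (mem_Ici.2 (by positivity)) (mem_Ici.2 (by positivity)) h1
        _ ≤ κ * Ψ (β * Ψ.inv (1 / (1 - ‖(z : ℂ)‖) ^ 2)) := Ψ.le_mul hβs hκ0.le hκ1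
        _ ≤ κ * (1 - ‖(z : ℂ)‖) ^ (-1 / 2 : ℝ) := by gcongr
        _ ≤ _ := by linarith
    · have h1 := hhσ (φ z) (hσz z hz)
      rw [← div_le_iff₀' hη, OrliczFunction.le_inv_iff (by positivity) (by norm_num)] at h1
      have : 0 ≤ κ * (1 - ‖(z : ℂ)‖) ^ (-1 / 2 : ℝ) := by positivity
      linarith
  calc _ ≤ ∫⁻ z : Disk, (ENNReal.ofReal (1 / 2) + ENNReal.ofReal κ *
        ENNReal.ofReal ((1 - ‖(z : ℂ)‖) ^ (-1 / 2 : ℝ))) ∂Disk.area := by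
        refine lintegral_mono fun z => ?_
        have hz1 := sub_pos.2 z.norm_lt_one
        rw [← ENNReal.ofReal_mul hκ0.le, ← ENNReal.ofReal_add (by norm_num) (by positivity)]
        exact ENNReal.ofReal_le_ofReal (hpt z)
    _ = ENNReal.ofReal (1 / 2) + ENNReal.ofReal (κ * W) := by
        rw [lintegral_add_left measurable_const, lintegral_const, Disk.area_univ, mul_one,
          lintegral_const_mul' _ _ ENNReal.ofReal_ne_top, hWe, ENNReal.ofReal_mul hκ0.le]
    _ ≤ 1 := by
        rw [← ENNReal.ofReal_add (by norm_num) (by positivity), ENNReal.ofReal_le_one]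
        linarith

/-! ### Compactness of the growth class and sufficiency of the condition -/

/-- The analytic functions satisfying the growth bound of the unit ball of `𝓑^Ψ`, with the topology
of pointwise convergence. -/
def growthClass (Ψ : OrliczFunction) : Set (Disk → ℂ) :=
  {f | Disk.Analytic f ∧ ∀ w : Disk, ‖f w‖ ≤ Ψ.inv (1 / (1 - ‖(w : ℂ)‖) ^ 2)}

lemma norm_extend_le_of_mem_growthClass {Ψ : OrliczFunction} {f : Disk → ℂ}
    (hf : f ∈ growthClass Ψ) {r : ℝ} (hr : r < 1) {z : ℂ} (hz : ‖z‖ ≤ r) :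
    ‖Disk.extend f z‖ ≤ Ψ.inv (1 / (1 - r) ^ 2) := by
  have h1 : z ∈ Metric.ball (0 : ℂ) 1 := mem_ball_zero_iff.2 (hz.trans_lt hr)
  rw [Disk.extend_of_mem f h1]
  refine (hf.2 ⟨z, h1⟩).trans (OrliczFunction.inv_le_inv (by positivity) ?_)
  have := sub_pos.2 hr
  gcongr

lemma growthClass.tendstoUniformlyOn {Ψ : OrliczFunction} {l : Filter (growthClass Ψ)}
    {f : Disk → ℂ} (hl : Tendsto (Subtype.val : growthClass Ψ → Disk → ℂ) l (𝓝 f)) {ρ : ℝ}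
    (hρ : ρ < 1) :
    TendstoUniformlyOn (fun s : growthClass Ψ => Disk.extend s) (Disk.extend f) l
      (Metric.closedBall 0 ρ) := by
  refine tendstoUniformlyOn_of_pointwise (B := fun r => Ψ.inv (1 / (1 - r) ^ 2))
    (fun s => Disk.analytic_iff.1 s.2.1)
    (fun s r hr z hz => norm_extend_le_of_mem_growthClass s.2 hr hz) (fun z hz => ?_) hρ
  simp only [Disk.extend_of_mem _ hz]
  exact tendsto_pi_nhds.1 hl ⟨z, hz⟩

/-- Montel's theorem through Tychonoff: the class lies in a product of closed disks, and it is
closed there because its pointwise limits are locally uniform, hence analytic. -/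
lemma isCompact_growthClass (Ψ : OrliczFunction) : IsCompact (growthClass Ψ) := by
  refine (isCompact_univ_pi fun w : Disk => isCompact_closedBall (0 : ℂ)
    (Ψ.inv (1 / (1 - ‖(w : ℂ)‖) ^ 2))).of_isClosed_subset ?_ fun f hf w _ =>
      mem_closedBall_zero_iff.2 (hf.2 w)
  refine isClosed_of_closure_subset fun f hf => ?_
  have hne := mem_closure_iff_comap_neBot.1 hf
  have hl : Tendsto (Subtype.val : growthClass Ψ → Disk → ℂ) (comap Subtype.val (𝓝 f)) (𝓝 f) :=
    tendsto_comap
  refine ⟨Disk.analytic_iff.2 ?_, fun w => ?_⟩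
  · refine TendstoLocallyUniformlyOn.differentiableOn (φ := comap Subtype.val (𝓝 f))
      (F := fun s : growthClass Ψ => Disk.extend s) ?_
      (Eventually.of_forall fun s => Disk.analytic_iff.1 s.2.1) Metric.isOpen_ball
    rw [tendstoLocallyUniformlyOn_iff_forall_isCompact Metric.isOpen_ball]
    intro K hK hKc
    obtain ⟨ρ, hρ, hKρ⟩ := exists_lt_subset_ball hKc.isClosed hK
    exact (growthClass.tendstoUniformlyOn hl hρ).mono
      (hKρ.trans Metric.ball_subset_closedBall)
  · exact le_of_tendsto ((tendsto_pi_nhds.1 hl w).norm) (Eventually.of_forall fun s => s.2.2 w)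

lemma comp_mem_of_mem_growthClass {Ψ : OrliczFunction} {φ : Disk → Disk}
    (hφ : Disk.Analytic fun z => (φ z : ℂ)) (hΔ : Ψ.DeltaSq) (hc : BergmanCompactCondition Ψ φ)
    {f : Disk → ℂ} (hf : f ∈ growthClass Ψ) : f ∘ φ ∈ bergmanOrliczSubmodule Ψ := by
  refine ⟨hf.1.comp hφ, ?_⟩
  obtain ⟨σ, hσ, δ, hδ, H⟩ := exists_orliczModular_comp_le_one hφ hΔ hc one_pos
  set B := Ψ.inv (1 / (1 - σ) ^ 2) with hB
  have hB0 : 0 ≤ B := OrliczFunction.inv_nonneg (by positivity)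
  -- Scaling by `c` brings `f` below `δ` on `|w| ≤ σ`, where it is bounded by `B`.
  set c : ℝ := (B / δ + 1)⁻¹ with hcdef
  have hc0 : 0 < c := by positivity
  have hc1 : c ≤ 1 := inv_le_one_of_one_le₀ (by linarith [div_nonneg hB0 hδ.le])
  have hcB : c * B ≤ δ := by
    rw [hcdef, inv_mul_le_iff₀ (by positivity), add_mul, div_mul_cancel₀ _ hδ.ne']
    linarith
  have hcn : ‖(c : ℂ)‖ = c := Complex.norm_of_nonneg hc0.le
  have h1 := H ((c : ℂ) • f) (fun w => ?_) fun w hw => ?_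
  · refine ⟨c⁻¹ * 1, by positivity, lt_of_eq_of_lt ?_ (h1.trans_lt ENNReal.one_lt_top)⟩
    have := orliczModular_smul Ψ (f ∘ φ) (c := (c : ℂ)) (by exact_mod_cast hc0.ne') (c⁻¹ * 1)
    rw [← this, hcn, mul_inv_cancel_left₀ hc0.ne']
    rfl
  · rw [Pi.smul_apply, smul_eq_mul, norm_mul, hcn]
    have h2 := hf.2 w
    nlinarith [norm_nonneg (f w)]
  · rw [Pi.smul_apply, smul_eq_mul, norm_mul, hcn]
    have h2 := norm_extend_le_of_mem_growthClass hf hσ hw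
    rw [Disk.extend_coe] at h2
    exact (mul_le_mul_of_nonneg_left h2 hc0.le).trans hcB

lemma comp_mem_bergmanOrliczSubmodule {Ψ : OrliczFunction} {φ : Disk → Disk}
    (hφ : Disk.Analytic fun z => (φ z : ℂ)) (hΔ : Ψ.DeltaSq) (hc : BergmanCompactCondition Ψ φ)
    (f : BergmanOrlicz Ψ) : (f : Disk → ℂ) ∘ φ ∈ bergmanOrliczSubmodule Ψ := by
  obtain ⟨C, hC, hfC⟩ := f.nonempty_set
  have hC' : (C : ℂ) ≠ 0 := by exact_mod_cast hC.ne'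
  have hmem : (C : ℂ)⁻¹ • (f : Disk → ℂ) ∈ growthClass Ψ := by
    refine ⟨((bergmanOrliczSubmodule Ψ).smul_mem _ f.2).1, fun w => ?_⟩
    rw [Pi.smul_apply, smul_eq_mul, norm_mul, norm_inv, Complex.norm_of_nonneg hC.le,
      inv_mul_le_iff₀ hC]
    exact norm_apply_le Ψ f.2.1 hC hfC w
  have h := (bergmanOrliczSubmodule Ψ).smul_mem (C : ℂ)
    (comp_mem_of_mem_growthClass hφ hΔ hc hmem)
  have he : (C : ℂ) • (((C : ℂ)⁻¹ • (f : Disk → ℂ)) ∘ φ) = (f : Disk → ℂ) ∘ φ := by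
    funext z
    simp [hC']
  rwa [he] at h

theorem BergmanCompactCondition.isCompactCompositionOperator {Ψ : OrliczFunction}
    {φ : Disk → Disk} (hφ : Disk.Analytic fun z => (φ z : ℂ)) (hΔ : Ψ.DeltaSq)
    (hc : BergmanCompactCondition Ψ φ) : IsCompactCompositionOperator Ψ φ := by
  let T : BergmanOrlicz Ψ →ₗ[ℂ] BergmanOrlicz Ψ :=
    { toFun := fun f => ⟨(f : Disk → ℂ) ∘ φ, comp_mem_bergmanOrliczSubmodule hφ hΔ hc f⟩
      map_add' := fun _ _ => rfl
      map_smul' := fun _ _ => rfl }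
  let J : growthClass Ψ → BergmanOrlicz Ψ := fun f =>
    ⟨(f : Disk → ℂ) ∘ φ, comp_mem_of_mem_growthClass hφ hΔ hc f.2⟩
  -- Pointwise convergence within the class is uniform on `|w| ≤ σ`, which is the smallness the
  -- modular estimate asks for.
  have hJ : Continuous J := by
    refine continuous_iff_continuousAt.2 fun f => ?_
    refine Metric.tendsto_nhds.2 fun ε hε => ?_
    obtain ⟨σ, hσ, δ, hδ, H⟩ := exists_orliczModular_comp_le_one hφ hΔ hc (half_pos hε)
    have hu := Metric.tendstoUniformlyOn_iff.1
      (growthClass.tendstoUniformlyOn (continuous_subtype_val.tendsto f) hσ) δ hδ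
    filter_upwards [hu] with g hg
    rw [dist_eq_norm]
    refine lt_of_le_of_lt ?_ (half_lt_self hε)
    refine BergmanOrlicz.norm_le_of_modular _ (half_pos hε)
      (H ((g : Disk → ℂ) - f) (fun w => ?_) fun w hw => ?_)
    · have h1 := norm_sub_le ((g : Disk → ℂ) w) ((f : Disk → ℂ) w)
      rw [Pi.sub_apply]
      linarith [g.2.2 w, f.2.2 w]
    · have h1 := hg w (mem_closedBall_zero_iff.2 hw)
      rw [Disk.extend_coe, Disk.extend_coe, dist_comm, dist_eq_norm] at h1
      exact h1.le
  have : CompactSpace (growthClass Ψ) := isCompact_iff_compactSpace.1 (isCompact_growthClass Ψ)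
  have hT : IsCompactOperator T := by
    refine (isCompactOperator_iff_image_closedBall_subset_compact T one_pos).2
      ⟨range J, isCompact_range hJ, ?_⟩
    rintro _ ⟨f, hf, rfl⟩
    refine ⟨⟨f, f.2.1, fun w => (f.norm_apply_le w).trans ?_⟩, rfl⟩
    exact mul_le_of_le_one_left (OrliczFunction.inv_nonneg (by positivity))
      (mem_closedBall_zero_iff.1 hf)
  -- Boundedness is a consequence of compactness.
  exact ⟨ContinuousLinearMap.mkOfIsCompactOperator hT, fun f z => rfl, hT⟩

/-! ### The case of `Ψ₂` -/

namespace OrliczFunction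

lemma expSq_inv_sq {t : ℝ} (ht : 0 ≤ t) : expSq.inv t ^ 2 = Real.log (1 + t) := by
  have h : Real.exp (expSq.inv t ^ 2) - 1 = t := apply_inv (Ψ := expSq) ht
  rw [← Real.log_exp (expSq.inv t ^ 2)]
  congr 1
  linarith

lemma neg_two_mul_log_le_expSq_inv_sq {r : ℝ} (hr : 0 < r) :
    -2 * Real.log r ≤ expSq.inv (1 / r ^ 2) ^ 2 := by
  rw [expSq_inv_sq (by positivity)]
  calc -2 * Real.log r = Real.log (1 / r ^ 2) := by
        rw [one_div, Real.log_inv, Real.log_pow]; push_cast; ring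
    _ ≤ _ := Real.log_le_log (by positivity) (by linarith)

lemma expSq_inv_sq_le {r : ℝ} (hr : 0 < r) (hr1 : r ≤ 1) :
    expSq.inv (1 / r ^ 2) ^ 2 ≤ Real.log 2 - 2 * Real.log r := by
  rw [expSq_inv_sq (by positivity)]
  have h1 : 1 ≤ 1 / r ^ 2 := by
    rw [le_div_iff₀ (by positivity), one_mul]
    exact pow_le_one₀ hr.le hr1
  calc _ ≤ Real.log (2 * (1 / r ^ 2)) := Real.log_le_log (by positivity) (by linarith)
    _ = _ := by
        rw [Real.log_mul (by norm_num) (by positivity), one_div, Real.log_inv, Real.log_pow]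
        push_cast; ring

lemma expSq_deltaSq : expSq.DeltaSq := by
  refine ⟨2, by norm_num, Eventually.of_forall fun x => ?_⟩
  change (Real.exp (x ^ 2) - 1) ^ 2 ≤ Real.exp ((2 * x) ^ 2) - 1
  have h1 : 1 ≤ Real.exp (x ^ 2) := Real.one_le_exp (by positivity)
  have h2 : Real.exp (x ^ 2) ^ 2 ≤ Real.exp ((2 * x) ^ 2) := by
    rw [← Real.exp_nat_mul]
    refine Real.exp_le_exp.2 ?_
    push_cast
    nlinarith [sq_nonneg x]
  nlinarith

end OrliczFunction

open OrliczFunction in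
theorem BergmanCompactCondition.powerCondition {φ : Disk → Disk}
    (hφ : Disk.Analytic fun z => (φ z : ℂ)) (h : BergmanCompactCondition expSq φ) :
    PowerCondition φ := by
  intro ε hε
  have hev : ∀ᶠ z in Disk.boundaryFilter, _ := h.eventually_lt_const (Real.sqrt_pos.2 hε)
  obtain ⟨ρ, hρ, hρz⟩ := Disk.eventually_boundaryFilter.1 hev
  obtain ⟨σ, hσ, hσz⟩ := Disk.exists_norm_le_of_norm_le hφ hρ
  -- The exponential absorbs the `log 2` of `expSq_inv_sq_le` near the circle, and `1 - σ` serves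
  -- `|z| ≤ ρ`.
  refine ⟨min (Real.exp (-(ε * Real.log 2 / 2))) (1 - σ),
    lt_min (Real.exp_pos _) (sub_pos.2 hσ), fun z => ?_⟩
  have hz := sub_pos.2 z.norm_lt_one
  have hz' : 1 - ‖(z : ℂ)‖ ≤ 1 := by linarith [norm_nonneg (z : ℂ)]
  have hw := sub_pos.2 (φ z).norm_lt_one
  have hpow : 0 ≤ (1 - ‖(z : ℂ)‖) ^ ε := Real.rpow_nonneg hz.le ε
  rcases lt_or_ge ρ ‖(z : ℂ)‖ with hzρ | hzρ
  · refine (mul_le_mul_of_nonneg_right (min_le_left _ _) hpow).trans ?_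
    have h1 := hρz z hzρ
    rw [div_lt_iff₀ (inv_pos (by positivity))] at h1
    have h2 := pow_le_pow_left₀ (inv_nonneg (by positivity)) h1.le 2
    rw [mul_pow, Real.sq_sqrt hε.le] at h2
    have h3 := (neg_two_mul_log_le_expSq_inv_sq hw).trans
      (h2.trans (mul_le_mul_of_nonneg_left (expSq_inv_sq_le hz hz') hε.le))
    rw [Real.rpow_def_of_pos hz, ← Real.exp_add, ← Real.le_log_iff_exp_le hw]
    linarith
  · refine (mul_le_mul_of_nonneg_right (min_le_right _ _) hpow).trans ?_
    have h1 : (1 - ‖(z : ℂ)‖) ^ ε ≤ 1 := Real.rpow_le_one hz.le hz' hε.le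
    have h2 := mul_le_of_le_one_right (sub_pos.2 hσ).le h1
    linarith [hσz z hzρ]

open OrliczFunction in
theorem PowerCondition.bergmanCompactCondition {φ : Disk → Disk} (h : PowerCondition φ) :
    BergmanCompactCondition expSq φ := by
  refine Metric.tendsto_nhds.2 fun ε hε => ?_
  -- This exponent uses only half of the available `ε² Ψ₂⁻¹(1 / (1 - |z|)²)²`. The other half
  -- absorbs the constant `log 2 - 2 log c`.
  obtain ⟨c, hc, hcz⟩ := h (ε ^ 2 / 2) (by positivity)
  have hev := ((tendsto_pow_atTop two_ne_zero).comp
    expSq.tendsto_inv_boundary).eventually_gt_atTop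
      ((Real.log 2 - 2 * Real.log c) / (ε ^ 2 / 2))
  change ∀ᶠ z in Disk.boundaryFilter, _
  filter_upwards [hev] with z hz
  rw [Function.comp, div_lt_iff₀' (by positivity)] at hz
  have hr := sub_pos.2 z.norm_lt_one
  have hw := sub_pos.2 (φ z).norm_lt_one
  have hx := inv_pos (Ψ := expSq) (show 0 < 1 / (1 - ‖(z : ℂ)‖) ^ 2 by positivity)
  have hy := inv_pos (Ψ := expSq) (show 0 < 1 / (1 - ‖(φ z : ℂ)‖) ^ 2 by positivity)
  rw [Real.dist_eq, sub_zero, abs_of_pos (div_pos hy hx), div_lt_iff₀ hx]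
  refine lt_of_pow_lt_pow_left₀ 2 (by positivity) ?_
  have h1 := expSq_inv_sq_le hw (by linarith [norm_nonneg (φ z : ℂ)])
  have h2 := neg_two_mul_log_le_expSq_inv_sq hr
  have h3 := Real.log_le_log (mul_pos hc (Real.rpow_pos_of_pos hr _)) (hcz z)
  rw [Real.log_mul hc.ne' (Real.rpow_pos_of_pos hr _).ne', Real.log_rpow hr] at h3
  have h4 := mul_le_mul_of_nonneg_left h2 (show 0 ≤ ε ^ 2 / 2 by positivity)
  rw [mul_pow]
  linarith

theorem mainTheorem11 (φ : Disk → Disk) (hφ : Disk.Analytic fun z => (φ z : ℂ)) :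
    (∀ Ψ : OrliczFunction,
      (IsCompactCompositionOperator Ψ φ → BergmanCompactCondition Ψ φ) ∧
      (Ψ.DeltaSq → BergmanCompactCondition Ψ φ → IsCompactCompositionOperator Ψ φ)) ∧
    (BergmanCompactCondition OrliczFunction.expSq φ ↔ PowerCondition φ) ∧
    (IsCompactCompositionOperator OrliczFunction.expSq φ ↔ PowerCondition φ) := by
  refine ⟨fun Ψ => ⟨fun h => h.bergmanCompactCondition,
    fun hΔ h => h.isCompactCompositionOperator hφ hΔ⟩,
    ⟨fun h => h.powerCondition hφ, fun h => h.bergmanCompactCondition⟩,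
    ⟨fun h => h.bergmanCompactCondition.powerCondition hφ, fun h =>
      h.bergmanCompactCondition.isCompactCompositionOperator hφ OrliczFunction.expSq_deltaSq⟩⟩
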